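/- Let $1\le p,q<\infty$ with $p/q\notin\mathbb N$, and let $L_p(L_q)=L_p([0,1];L_q[0,1])$ (Lebesgue measure). A lattice embedding is a linear isometry (into) that is a lattice homomorphism, and for elements $x_i$ of $L_p(L_q)$, $\langle x_i\rangle_i$ denotes the closed sublattice they generate. Let $B\mathcal K_{p,q}$ be the class of finite-dimensional $BL_pL_q$ lattices, that is, of the finite-dimensional Banach lattices that are lattice isometric to a band of $L_p(\Omega;L_q(\Omega'))$ for some measure spaces $\Omega,\Omega'$. Let $\mathcal K_{p,q}$ be the class of sublattices (up to lattice isometry) of members of $B\mathcal K_{p,q}$. Let $e_1,\dots,e_m$ be mutually disjoint positive elements of norm one in $L_p(L_q)$, and let $E=\langle e_1,\dots,e_m\rangle$. Then the following hold. (1) $E\in\mathcal K_{p,q}$ if and only if there are $L\in\mathbb N$, a set $I\subseteq\{1,\dots,L\}\times\{1,\dots,m\}$ and mutually disjoint positive norm-one elements $\varphi(k,j)$, $(k,j)\in I$, of $L_p(L_q)$ such that (a) for each $j$, $e_j\in\langle\varphi(k,j)\rangle_{k:(k,j)\in I}$, and the elements $\varphi(k,j)$, $k$ with $(k,j)\in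 I$, are isometrically equivalent to the unit vector basis of a finite-dimensional $\ell_p$, i.e. $\|\sum_k a_k\varphi(k,j)\|^p=\sum_k|a_k|^p$ for all real $a_k$; (b) $\langle\varphi(k,j)\rangle_{(k,j)\in I}\in B\mathcal K_{p,q}$. If $E\in\mathcal K_{p,q}$, the $\varphi(k,j)$ can moreover be chosen so that for each $k$ the $\varphi(k,j)$ with $(k,j)\in I$ form the $k$-th $\ell_q$ block of an $\ell_p$-sum, i.e. $\|\sum_{(k,j)\in I}a_{k,j}\varphi(k,j)\|^p=\sum_{k=1}^L\big(\sum_{j:(k,j)\in I}|a_{k,j}|^q\big)^{p/q}$ for all real $a_{k,j}$. (2) If $E\in\mathcal K_{p,q}$ and $f_1,f_2:E\to L_p(L_q)$ are lattice embeddings, then there are $E'\in B\mathcal K_{p,q}$, a lattice embedding $\iota:E\to E'$ and lattice embeddings $f_1',f_2':E'\to L_p(L_q)$ such that $f_i'\circ\iota=f_i$ for $i=1,2$. -/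

import Mathlib

open MeasureTheory
open scoped ENNReal

noncomputable section

/-- The concrete lattice `L_p(Ω; L_q(Ω'))` of (classes of) Bochner measurable functions
`f : Ω → L_q(Ω')` with `ω ↦ ‖f ω‖_q` in `L_p(Ω)`, with its norm and its almost everywhere order. -/
abbrev MixedLp {Ω Ω' : Type*} [MeasurableSpace Ω] [MeasurableSpace Ω'] (p q : ℝ≥0∞)
    [Fact (1 ≤ q)] (μ : Measure Ω) (ν : Measure Ω') :=
  Lp (Lp ℝ q ν) p μ

/-- `L_p(L_q) = L_p([0,1]; L_q[0,1])` with Lebesgue measure on both factors. -/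
abbrev LpLq (p q : ℝ≥0∞) [Fact (1 ≤ q)] :=
  MixedLp p q (volume : Measure unitInterval) (volume : Measure unitInterval)

/-- A linear isometry that is a lattice homomorphism: an (isometric) lattice embedding. -/
def IsLatticeEmbedding {E F : Type*} [NormedAddCommGroup E] [NormedSpace ℝ E] [Lattice E]
    [NormedAddCommGroup F] [NormedSpace ℝ F] [Lattice F] (f : E →ₗᵢ[ℝ] F) : Prop :=
  ∀ x y : E, f (x ⊔ y) = f x ⊔ f y ∧ f (x ⊓ y) = f x ⊓ f y

/-- A band of a normed lattice: a solid linear subspace that contains every supremum (taken in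
the whole lattice) of its subsets. -/
def IsBand {X : Type*} [NormedAddCommGroup X] [NormedSpace ℝ X] [Lattice X]
    (S : Submodule ℝ X) : Prop :=
  (∀ x y : X, y ∈ S → |x| ≤ |y| → x ∈ S) ∧
    ∀ (A : Set X) (x : X), A ⊆ (S : Set X) → IsLUB A x → x ∈ S

/-- The class of finite-dimensional `BL_pL_q` lattices: the finite-dimensional lattices that are
lattice isometric to a band of some `L_p(Ω; L_q(Ω'))`. -/
def IsBK (p q : ℝ≥0∞) [Fact (1 ≤ p)] [Fact (1 ≤ q)] (E : Type*) [NormedAddCommGroup E]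
    [NormedSpace ℝ E] [Lattice E] : Prop :=
  FiniteDimensional ℝ E ∧
    ∃ (Ω Ω' : Type) (_ : MeasurableSpace Ω) (_ : MeasurableSpace Ω') (μ : Measure Ω)
      (ν : Measure Ω') (f : E →ₗᵢ[ℝ] MixedLp p q μ ν),
      IsLatticeEmbedding f ∧ IsBand (LinearMap.range f.toLinearMap)

/-- The class of lattices that are (lattice isometric to) sublattices of finite-dimensional
`BL_pL_q` lattices. -/
def IsK (p q : ℝ≥0∞) [Fact (1 ≤ p)] [Fact (1 ≤ q)] (E : Type*) [NormedAddCommGroup E]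
    [NormedSpace ℝ E] [Lattice E] : Prop :=
  ∃ (F : Type) (_ : NormedAddCommGroup F) (_ : NormedSpace ℝ F) (_ : Lattice F),
    IsBK p q F ∧ ∃ f : E →ₗᵢ[ℝ] F, IsLatticeEmbedding f

/-- A closed linear sublattice of a normed lattice. -/
structure ClosedSublattice (X : Type*) [NormedAddCommGroup X] [NormedSpace ℝ X] [Lattice X]
    extends Submodule ℝ X where
  sup_mem' : ∀ ⦃x y : X⦄, x ∈ carrier → y ∈ carrier → x ⊔ y ∈ carrier
  inf_mem' : ∀ ⦃x y : X⦄, x ∈ carrier → y ∈ carrier → x ⊓ y ∈ carrier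
  isClosed' : IsClosed carrier

/-- A closed sublattice is a lattice under the operations of the ambient lattice. -/
instance ClosedSublattice.instLattice {X : Type*} [NormedAddCommGroup X] [NormedSpace ℝ X]
    [Lattice X] (S : ClosedSublattice X) : Lattice S.toSubmodule :=
  Subtype.lattice (P := fun x : X => x ∈ S.toSubmodule)
    (fun _ _ hx hy => S.sup_mem' hx hy) (fun _ _ hx hy => S.inf_mem' hx hy)

/-- The Banach lattice generated by a set: the smallest closed linear sublattice containing it. -/
def ClosedSublattice.generate {X : Type*} [NormedAddCommGroup X] [NormedSpace ℝ X]
    [Lattice X] (s : Set X) : ClosedSublattice X where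
  carrier := {x | ∀ S : ClosedSublattice X, s ⊆ (S.toSubmodule : Set X) → x ∈ S.toSubmodule}
  add_mem' := fun hx hy S hS => S.toSubmodule.add_mem (hx S hS) (hy S hS)
  zero_mem' := fun S _ => S.toSubmodule.zero_mem
  smul_mem' := fun c _ hx S hS => S.toSubmodule.smul_mem c (hx S hS)
  sup_mem' := fun _ _ hx hy S hS => S.sup_mem' (hx S hS) (hy S hS)
  inf_mem' := fun _ _ hx hy S hS => S.inf_mem' (hx S hS) (hy S hS)
  isClosed' := by
    simp only [Set.ofPred_forall]
    exact isClosed_iInter fun S => isClosed_iInter fun _ => S.isClosed'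

/-- A family of mutually disjoint positive elements of norm one. -/
def IsDisjointNormalizedPositive {X ι : Type*} [NormedAddCommGroup X] [Lattice X]
    (x : ι → X) : Prop :=
  (∀ i, 0 ≤ x i) ∧ (∀ i, ‖x i‖ = 1) ∧ ∀ i i', i ≠ i' → x i ⊓ x i' = 0

/-- The family `φ(k,j)`, indexed by a set `I` of pairs `(k,j)`, consists of mutually disjoint
normalized positive elements; each `e_j` lies in the lattice generated by the `φ(k,j)` in column
`j`, which are isometrically equivalent to the unit vector basis of a finite-dimensional `ℓ_p`;
and all the `φ(k,j)` together generate a finite-dimensional `BL_pL_q` lattice. -/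
def IsAtomRefinement (p q : ℝ≥0∞) [Fact (1 ≤ p)] [Fact (1 ≤ q)] {m L : ℕ}
    (e : Fin m → LpLq p q) (I : Finset (Fin L × Fin m)) (φ : I → LpLq p q) : Prop :=
  IsDisjointNormalizedPositive φ ∧
  (∀ j : Fin m, e j ∈ (ClosedSublattice.generate (φ '' {i : I | i.1.2 = j})).toSubmodule) ∧
  (∀ (j : Fin m) (a : I → ℝ),
    ‖∑ i : I with i.1.2 = j, a i • φ i‖ ^ p.toReal =
      ∑ i : I with i.1.2 = j, |a i| ^ p.toReal) ∧
  IsBK p q (ClosedSublattice.generate (Set.range φ)).toSubmodule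

/-- For each `k`, the elements `φ(k,j)` in row `k` form the unit vector basis of the `k`-th summand
of an `ℓ_p`-sum of finite-dimensional `ℓ_q` spaces. -/
def HasRowBlocks (p q : ℝ≥0∞) [Fact (1 ≤ p)] [Fact (1 ≤ q)] {m L : ℕ}
    (I : Finset (Fin L × Fin m)) (φ : I → LpLq p q) : Prop :=
  ∀ a : I → ℝ, ‖∑ i : I, a i • φ i‖ ^ p.toReal =
    ∑ k : Fin L, (∑ i : I with i.1.1 = k, |a i| ^ q.toReal) ^ (p.toReal / q.toReal)

end

/-! Put `r = p/q`. For disjoint positive `h_j` in `L_p(L_q)` with fibre norms `N_j(ω)`, disjointness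
gives `‖∑ a_j h_j‖^p = ∫ (∑ |a_j|^q N_j^q)^r`. Dividing the vector `(N_j^q)` by its sum `M` gives a
point of the simplex, the fibre profile. The image of `M^r μ` under the profile is a finite measure
`σ` with `‖∑ b_j^(1/q) h_j‖^p = ∫ (∑ b_j x_j)^r dσ` for `b ≥ 0`.

Since `r` is not a natural number, these integrals determine `σ` (`measure_eq_of_integral_rpow_eq`):
near `b = (1,…,1)` they have the form `∫ (1 + tL)^r dσ` with `L` linear, and the `n`-th derivative
at `t = 0` is `∫ L^n dσ` times the nonzero factor `r(r-1)⋯(r-n+1)`. The moments of all linear forms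
give the characteristic function. Hence lattice embeddings preserve `σ`.

If the family lies in a finite-dimensional band, `σ` has finite support, since disjoint regions of
profiles cut out disjoint nonzero elements of the band. So `E ∈ K` makes `σ` a finite sum of atoms
`x_k`. On the level set of `x_k` the fibre norms are in constant ratio, so the normalized pieces of
the `e_j` there form an `ℓ_q` block; different level sets are disjoint in `Ω`, so the blocks add up
in `ℓ_p` (`exists_rowBlock_decomposition`). The coefficients of `e_j` on its pieces depend on `σ`
alone. Every embedding therefore splits the `e_j` in the same way, and it extends to the lattice of
pieces by sending piece to piece. -/

noncomputable section

/-! ### Disjoint positive families in vector lattices. -/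

section VectorLattice

theorem inf_add_eq_zero {X : Type*} [AddCommGroup X] [Lattice X] [IsOrderedAddMonoid X] {u v w : X} (hu : 0 ≤ u) (hv : 0 ≤ v) (hw : 0 ≤ w) (huv : u ⊓ v = 0)
    (huw : u ⊓ w = 0) : u ⊓ (v + w) = 0 := by
  refine le_antisymm ?_ (le_inf hu (add_nonneg hv hw))
  have h1 : u ⊓ (v + w) ≤ w := by
    have : u ⊓ (v + w) - w ≤ u ⊓ v := by
      refine le_inf ?_ ?_
      · exact (sub_le_self _ hw).trans inf_le_left
      · exact sub_le_iff_le_add.2 inf_le_right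
    rw [huv] at this
    exact sub_nonpos.1 this
  exact (le_inf inf_le_left h1).trans huw.le

theorem inf_sum_eq_zero {ι X : Type*} [AddCommGroup X] [Lattice X]
    [IsOrderedAddMonoid X] {u : X} {v : ι → X} (s : Finset ι) (hu : 0 ≤ u) (hv : ∀ i ∈ s, 0 ≤ v i)
    (huv : ∀ i ∈ s, u ⊓ v i = 0) : u ⊓ ∑ i ∈ s, v i = 0 := by
  classical
  induction s using Finset.induction_on with
  | empty => simpa using hu
  | insert a s ha ih =>
    rw [Finset.sum_insert ha]
    refine inf_add_eq_zero hu (hv _ (by simp)) (Finset.sum_nonneg fun i hi => hv i (by simp [hi]))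
      (huv _ (by simp)) (ih (fun i hi => hv i (by simp [hi])) fun i hi => huv i (by simp [hi]))

/-- Pairwise disjoint positive elements. -/
def IsDisjointPositive {ι X : Type*} [AddCommGroup X] [Lattice X] (x : ι → X) : Prop :=
  (∀ i, 0 ≤ x i) ∧ ∀ i i', i ≠ i' → x i ⊓ x i' = 0

/-- The linear combination map of a finite family. -/
def combination (ι : Type*) [Fintype ι] {X : Type*} [NormedAddCommGroup X] [NormedSpace ℝ X]
    (φ : ι → X) : (ι → ℝ) →ₗ[ℝ] X := Fintype.linearCombination ℝ φ

theorem combination_apply {ι X : Type*} [Fintype ι] [NormedAddCommGroup X] [NormedSpace ℝ X] (φ : ι → X) (a : ι → ℝ) :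
    combination ι φ a = ∑ i, a i • φ i := Fintype.linearCombination_apply ℝ φ a

section Generate

variable {X : Type*} [NormedAddCommGroup X] [NormedSpace ℝ X] [Lattice X]

theorem subset_generate (s : Set X) : s ⊆ ((ClosedSublattice.generate s).toSubmodule : Set X) :=
  fun _ hx _ hS => hS hx

theorem generate_le {s : Set X} {S : ClosedSublattice X} (h : s ⊆ (S.toSubmodule : Set X)) :
    (ClosedSublattice.generate s).toSubmodule ≤ S.toSubmodule :=
  fun _ hx => hx S h

end Generate

variable {ι X Y : Type*} [NormedAddCommGroup X] [NormedSpace ℝ X] [Lattice X]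
  [IsOrderedAddMonoid X] [PosSMulMono ℝ X]

/-- Natural multiples follow by adding copies of `v`; a real multiple is dominated by a natural one.
-/
theorem inf_smul_eq_zero {u v : X} (hu : 0 ≤ u) (hv : 0 ≤ v) (huv : u ⊓ v = 0) {t : ℝ}
    (ht : 0 ≤ t) : u ⊓ t • v = 0 := by
  have hn : ∀ n : ℕ, u ⊓ (n : ℝ) • v = 0 := by
    intro n
    induction n with
    | zero => simpa using hu
    | succ n ih =>
      push_cast
      rw [add_smul, one_smul]
      exact inf_add_eq_zero hu (smul_nonneg n.cast_nonneg hv) hv ih huv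
  obtain ⟨n, hn'⟩ := exists_nat_ge t
  refine le_antisymm ?_ (le_inf hu (smul_nonneg ht hv))
  rw [← hn n]
  refine inf_le_inf_left _ ?_
  rw [← sub_nonneg, ← sub_smul]
  exact smul_nonneg (sub_nonneg.2 hn') hv

theorem IsDisjointPositive.inf_sum_sum [Fintype ι] {φ : ι → X} (h : IsDisjointPositive φ)
    {s t : ι → ℝ} (hs : ∀ i, 0 ≤ s i) (ht : ∀ i, 0 ≤ t i) (hst : ∀ i, s i = 0 ∨ t i = 0) :
    (∑ i, s i • φ i) ⊓ ∑ i, t i • φ i = 0 := by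
  have hsp : ∀ i, 0 ≤ s i • φ i := fun i => smul_nonneg (hs i) (h.1 i)
  have htp : ∀ i, 0 ≤ t i • φ i := fun i => smul_nonneg (ht i) (h.1 i)
  refine inf_sum_eq_zero _ (Finset.sum_nonneg fun i _ => hsp i) (fun i _ => htp i) fun j _ => ?_
  rw [inf_comm]
  refine inf_sum_eq_zero _ (htp j) (fun i _ => hsp i) fun i _ => ?_
  by_cases hij : j = i
  · subst hij
    rcases hst j with h0 | h0
    · rw [h0, zero_smul]; exact inf_eq_right.2 (htp j)
    · rw [h0, zero_smul]; exact inf_eq_left.2 (hsp j)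
  · refine inf_smul_eq_zero (htp j) (h.1 i) ?_ (hs i)
    rw [inf_comm]
    exact inf_smul_eq_zero (h.1 i) (h.1 j) (h.2 i j (Ne.symm hij)) (ht j)

/-- Removing the common part `∑ (a i ⊓ b i) • φ i` from both sums leaves at each index at least one
zero coefficient. The remainders are therefore disjoint, and the common part can be added back. -/
theorem IsDisjointPositive.sum_inf [Fintype ι] {φ : ι → X} (h : IsDisjointPositive φ)
    (a b : ι → ℝ) :
    (∑ i, a i • φ i) ⊓ ∑ i, b i • φ i = ∑ i, (a i ⊓ b i) • φ i := by
  have key := h.inf_sum_sum (s := fun i => a i - a i ⊓ b i) (t := fun i => b i - a i ⊓ b i)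
    (fun i => sub_nonneg.2 inf_le_left) (fun i => sub_nonneg.2 inf_le_right) (fun i => by
      rcases le_total (a i) (b i) with h | h
      · left; simp [h]
      · right; simp [h])
  have := congrArg (· + ∑ i, (a i ⊓ b i) • φ i) key
  simp only [inf_add, zero_add] at this
  rw [← this]
  simp only [sub_smul, Finset.sum_sub_distrib, sub_add_cancel]

theorem IsDisjointPositive.sum_sup [Fintype ι] {φ : ι → X} (h : IsDisjointPositive φ)
    (a b : ι → ℝ) :
    (∑ i, a i • φ i) ⊔ ∑ i, b i • φ i = ∑ i, (a i ⊔ b i) • φ i := by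
  have h1 := inf_add_sup (∑ i, a i • φ i) (∑ i, b i • φ i)
  rw [h.sum_inf, ← eq_sub_iff_add_eq'] at h1
  rw [h1, ← Finset.sum_add_distrib, ← Finset.sum_sub_distrib]
  refine Finset.sum_congr rfl fun i _ => ?_
  rw [← add_smul, ← sub_smul, ← inf_add_sup (a i) (b i), add_sub_cancel_left]

/-- The supremum of a vanishing combination and its negative is `∑ |a i| • φ i`, a vanishing sum of
positive terms. -/
theorem IsDisjointPositive.eq_zero_of_sum_eq_zero [Fintype ι] {φ : ι → X}
    (h : IsDisjointPositive φ) (hne : ∀ i, φ i ≠ 0) {a : ι → ℝ} (ha : ∑ i, a i • φ i = 0)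
    (i : ι) : a i = 0 := by
  have h1 := h.sum_sup a (fun i => - a i)
  simp only [neg_smul, Finset.sum_neg_distrib, ha, neg_zero, sup_idem] at h1
  have h2 : ∀ i ∈ Finset.univ, 0 ≤ (a i ⊔ -a i) • φ i :=
    fun i _ => smul_nonneg (abs_nonneg (a i)) (h.1 i)
  have h3 := (Finset.sum_eq_zero_iff_of_nonneg h2).1 h1.symm i (Finset.mem_univ i)
  rcases smul_eq_zero.1 h3 with h4 | h4
  · exact abs_eq_zero.1 h4
  · exact absurd h4 (hne i)

/-- The linear span is already a sublattice, by the coordinatewise formulas, and is closed because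
it is finite-dimensional. -/
theorem IsDisjointPositive.generate_eq [Fintype ι] {φ : ι → X} (h : IsDisjointPositive φ) :
    (ClosedSublattice.generate (Set.range φ)).toSubmodule = LinearMap.range (combination ι φ) := by
  classical
  apply le_antisymm
  · let S : ClosedSublattice X :=
      { LinearMap.range (combination ι φ) with
        sup_mem' := by
          rintro _ _ ⟨a, rfl⟩ ⟨b, rfl⟩
          exact ⟨fun i => a i ⊔ b i, by simp only [combination_apply, h.sum_sup]⟩
        inf_mem' := by
          rintro _ _ ⟨a, rfl⟩ ⟨b, rfl⟩
          exact ⟨fun i => a i ⊓ b i, by simp only [combination_apply, h.sum_inf]⟩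
        isClosed' := Submodule.closed_of_finiteDimensional (LinearMap.range (combination ι φ)) }
    refine generate_le (S := S) ?_
    rintro _ ⟨i, rfl⟩
    exact ⟨Pi.single i 1, by simp [combination_apply, Pi.single_apply]⟩
  · rintro _ ⟨a, rfl⟩
    rw [combination_apply]
    exact Submodule.sum_mem _ fun i _ => Submodule.smul_mem _ _ (subset_generate _ ⟨i, rfl⟩)

variable [NormedAddCommGroup Y] [NormedSpace ℝ Y] [Lattice Y]
  [IsOrderedAddMonoid Y] [PosSMulMono ℝ Y]

/-- Two disjoint families with the same norms of linear combinations generate isometric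
lattices. -/
theorem IsDisjointPositive.exists_latticeEmbedding [Fintype ι] {φ : ι → X} {ψ : ι → Y}
    (hφ : IsDisjointPositive φ) (hψ : IsDisjointPositive ψ) (hne : ∀ i, φ i ≠ 0)
    (hnorm : ∀ a : ι → ℝ, ‖∑ i, a i • ψ i‖ = ‖∑ i, a i • φ i‖) :
    ∃ g : (ClosedSublattice.generate (Set.range φ)).toSubmodule →ₗᵢ[ℝ] Y,
      IsLatticeEmbedding g ∧ (∀ (a : ι → ℝ) (x : (ClosedSublattice.generate (Set.range φ)).toSubmodule),
        (x : X) = ∑ i, a i • φ i → g x = ∑ i, a i • ψ i) ∧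
      LinearMap.range g.toLinearMap = LinearMap.range (combination ι ψ) := by
  have hinj : Function.Injective (combination ι φ) := by
    rw [← LinearMap.ker_eq_bot, LinearMap.ker_eq_bot']
    intro a ha
    rw [combination_apply] at ha
    exact funext fun i => hφ.eq_zero_of_sum_eq_zero hne ha i
  let T : (ι → ℝ) ≃ₗ[ℝ] (ClosedSublattice.generate (Set.range φ)).toSubmodule :=
    (LinearEquiv.ofInjective _ hinj).trans (LinearEquiv.ofEq _ _ hφ.generate_eq.symm)
  have hT : ∀ a, ((T a : (ClosedSublattice.generate (Set.range φ)).toSubmodule) : X)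
      = ∑ i, a i • φ i := fun a => combination_apply φ a
  have hT' : ∀ x : (ClosedSublattice.generate (Set.range φ)).toSubmodule,
      (x : X) = ∑ i, T.symm x i • φ i := fun x => by rw [← hT, T.apply_symm_apply]
  let g : (ClosedSublattice.generate (Set.range φ)).toSubmodule →ₗᵢ[ℝ] Y :=
    { toLinearMap := (combination ι ψ).comp T.symm.toLinearMap
      norm_map' := fun x => by
        change ‖combination ι ψ (T.symm x)‖ = ‖(x : X)‖
        rw [combination_apply, hnorm, ← hT'] }
  have hg : ∀ (a : ι → ℝ) (x : (ClosedSublattice.generate (Set.range φ)).toSubmodule),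
      (x : X) = ∑ i, a i • φ i → g x = ∑ i, a i • ψ i := by
    intro a x hx
    have : x = T a := Subtype.ext (by rw [hx, hT])
    change combination ι ψ (T.symm x) = _
    rw [this, T.symm_apply_apply, combination_apply]
  refine ⟨g, fun x y => ?_, hg, ?_⟩
  · rw [hg _ x (hT' x), hg _ y (hT' y), hψ.sum_sup, hψ.sum_inf]
    constructor
    · refine hg _ _ ?_
      change (x : X) ⊔ (y : X) = _
      rw [← hφ.sum_sup, ← hT', ← hT']
    · refine hg _ _ ?_
      change (x : X) ⊓ (y : X) = _
      rw [← hφ.sum_inf, ← hT', ← hT']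
  · change LinearMap.range ((combination ι ψ).comp T.symm.toLinearMap) = _
    exact LinearMap.range_comp_of_range_eq_top _ T.symm.range

end VectorLattice

end

noncomputable section

/-! ### Families in `L_p` spaces of lattice-valued functions. -/

section LpFamilies

variable {α ι E : Type*} [MeasurableSpace α] {μ : Measure α} {p : ℝ≥0∞} [NormedAddCommGroup E]

instance Lp.instPosSMulMono [NormedSpace ℝ E] [PartialOrder E] [PosSMulMono ℝ E] :
    PosSMulMono ℝ (Lp E p μ) where
  smul_le_smul_of_nonneg_left := fun c hc f g hfg => by
    rw [← Lp.coeFn_le] at hfg ⊢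
    filter_upwards [Lp.coeFn_smul c f, Lp.coeFn_smul c g, hfg] with x h1 h2 h3
    rw [h1, h2]
    exact smul_le_smul_of_nonneg_left h3 hc

theorem Lp.norm_rpow_eq_integral (hp0 : p ≠ 0) (hp : p ≠ ∞) (f : Lp E p μ) :
    ‖f‖ ^ p.toReal = ∫ x, ‖f x‖ ^ p.toReal ∂μ := by
  have hpos : 0 < p.toReal := ENNReal.toReal_pos hp0 hp
  have h0 : 0 ≤ ∫ x, ‖f x‖ ^ p.toReal ∂μ := integral_nonneg fun x => by positivity
  rw [Lp.norm_def, (Lp.memLp f).eLpNorm_eq_integral_rpow_norm hp0 hp,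
    ENNReal.toReal_ofReal (by positivity), ← Real.rpow_mul h0, inv_mul_cancel₀ hpos.ne',
    Real.rpow_one]

theorem Lp.coeFn_sum_smul [NormedSpace ℝ E] (s : Finset ι) (a : ι → ℝ) (f : ι → Lp E p μ) :
    ⇑(∑ i ∈ s, a i • f i) =ᵐ[μ] fun x => ∑ i ∈ s, a i • f i x := by
  classical
  induction s using Finset.induction_on with
  | empty =>
    simp only [Finset.sum_empty]
    exact Lp.coeFn_zero E p μ
  | insert i s hi ih =>
    rw [Finset.sum_insert hi]
    filter_upwards [Lp.coeFn_add (a i • f i) (∑ i ∈ s, a i • f i), ih, Lp.coeFn_smul (a i) (f i)]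
      with x h1 h2 h3
    rw [h1, Pi.add_apply, h2, h3, Finset.sum_insert hi, Pi.smul_apply]

/-- Moves disjointness to the fibres. It serves at both levels of `L_p(L_q)`: for functions with
values in `L_q` and for real functions. -/
theorem Lp.isDisjointPositive_iff [Countable ι] [Lattice E] [HasSolidNorm E]
    [IsOrderedAddMonoid E] {f : ι → Lp E p μ} :
    IsDisjointPositive f ↔ ∀ᵐ x ∂μ, IsDisjointPositive fun i => f i x := by
  simp only [IsDisjointPositive, Filter.eventually_and, ae_all_iff]
  refine and_congr (forall_congr' fun i => (Lp.coeFn_nonneg (f i)).symm)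
    (forall_congr' fun i => forall_congr' fun j => ?_)
  have h : f i ⊓ f j = 0 ↔ ∀ᵐ x ∂μ, f i x ⊓ f j x = 0 := by
    rw [Lp.eq_zero_iff_ae_eq_zero]
    constructor
    · intro h
      filter_upwards [h, Lp.coeFn_inf (f i) (f j)] with x h1 h2
      rw [← Pi.inf_apply, ← h2, h1, Pi.zero_apply]
    · intro h
      filter_upwards [h, Lp.coeFn_inf (f i) (f j)] with x h1 h2
      rw [h2, Pi.inf_apply, h1, Pi.zero_apply]
  rw [h]

/-- The class of `1_A f`. -/
def Lp.restrictTo {A : Set α} (hA : MeasurableSet A) (f : Lp E p μ) : Lp E p μ :=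
  ((Lp.memLp f).indicator hA).toLp _

theorem Lp.coeFn_restrictTo {A : Set α} (hA : MeasurableSet A) (f : Lp E p μ) :
    ⇑(Lp.restrictTo hA f) =ᵐ[μ] A.indicator f :=
  MemLp.coeFn_toLp _

end LpFamilies

/-! ### The norm of a combination of disjoint elements of `L_p(L_q)`. -/

section NormFormula

variable {ι Ω Ω' : Type*} [Fintype ι] [MeasurableSpace Ω] [MeasurableSpace Ω'] {p q : ℝ≥0∞}
  [Fact (1 ≤ p)] [Fact (1 ≤ q)] {μ : Measure Ω} {ν : Measure Ω'}

theorem toReal_pos_of_fact {p : ℝ≥0∞} [hp : Fact (1 ≤ p)] (hp' : p ≠ ∞) : 0 < p.toReal :=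
  ENNReal.toReal_pos (zero_lt_one.trans_le hp.out).ne' hp'

/-- Among pairwise disjoint nonnegative reals at most one is nonzero. -/
theorem abs_sum_rpow_of_isDisjointPositive {x : ι → ℝ} (hx : IsDisjointPositive x) (a : ι → ℝ)
    {s : ℝ} (hs : 0 < s) : |∑ i, a i * x i| ^ s = ∑ i, |a i| ^ s * |x i| ^ s := by
  by_cases h : ∃ i, x i ≠ 0
  · obtain ⟨i, hi⟩ := h
    have h0 : ∀ j, j ≠ i → x j = 0 := by
      intro j hj
      have h1 := hx.2 j i hj
      rcases min_choice (x j) (x i) with h2 | h2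
      · exact h2.symm.trans h1
      · exact absurd (h2.symm.trans h1) hi
    rw [Finset.sum_eq_single i (fun j _ hj => by rw [h0 j hj, mul_zero]) (by simp),
      Finset.sum_eq_single i (fun j _ hj => by
        rw [h0 j hj, abs_zero, Real.zero_rpow hs.ne', mul_zero]) (by simp), abs_mul,
      Real.mul_rpow (abs_nonneg _) (abs_nonneg _)]
  · push Not at h
    simp [h, Real.zero_rpow hs.ne']

theorem Lp.norm_sum_rpow_of_isDisjointPositive (hq : q ≠ ∞) {f : ι → Lp ℝ q ν}
    (hf : IsDisjointPositive f) (a : ι → ℝ) :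
    ‖∑ i, a i • f i‖ ^ q.toReal = ∑ i, |a i| ^ q.toReal * ‖f i‖ ^ q.toReal := by
  have hq0 : q ≠ 0 := (zero_lt_one.trans_le (Fact.out : 1 ≤ q)).ne'
  have hpos := toReal_pos_of_fact hq
  simp only [Lp.norm_rpow_eq_integral hq0 hq, ← integral_const_mul]
  rw [← integral_finsetSum]
  · refine integral_congr_ae ?_
    filter_upwards [(Lp.isDisjointPositive_iff (E := ℝ)).1 hf, Lp.coeFn_sum_smul Finset.univ a f] with x h1 h2
    rw [h2]
    exact abs_sum_rpow_of_isDisjointPositive h1 a hpos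
  · exact fun i _ => ((Lp.memLp (f i)).integrable_norm_rpow hq0 hq).const_mul _

/-- The `p`-th power of the norm of a combination of disjoint positive elements. -/
theorem MixedLp.norm_sum_rpow (hp : p ≠ ∞) (hq : q ≠ ∞) {h : ι → MixedLp p q μ ν}
    (hh : IsDisjointPositive h) (a : ι → ℝ) :
    ‖∑ i, a i • h i‖ ^ p.toReal =
      ∫ ω, (∑ i, |a i| ^ q.toReal * ‖h i ω‖ ^ q.toReal) ^ (p.toReal / q.toReal) ∂μ := by
  have hp0 : p ≠ 0 := (zero_lt_one.trans_le (Fact.out : 1 ≤ p)).ne'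
  have hpos := toReal_pos_of_fact hq
  rw [Lp.norm_rpow_eq_integral hp0 hp]
  refine integral_congr_ae ?_
  filter_upwards [(Lp.isDisjointPositive_iff (E := Lp ℝ q ν)).1 hh, Lp.coeFn_sum_smul Finset.univ a h] with x h1 h2
  rw [h2, ← Lp.norm_sum_rpow_of_isDisjointPositive hq h1, ← Real.rpow_mul (norm_nonneg _),
    mul_div_cancel₀ _ hpos.ne']

/-- Almost everywhere the integrand is the `p`-th power of the fibre norm of `∑ h i`. -/
theorem MixedLp.integrable_rpow_sum (hp : p ≠ ∞) (hq : q ≠ ∞) {h : ι → MixedLp p q μ ν}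
    (hh : IsDisjointPositive h) :
    Integrable (fun ω => (∑ i, ‖h i ω‖ ^ q.toReal) ^ (p.toReal / q.toReal)) μ := by
  have hp0 : p ≠ 0 := (zero_lt_one.trans_le (Fact.out : 1 ≤ p)).ne'
  have hpos := toReal_pos_of_fact hq
  refine ((Lp.memLp (∑ i, (1 : ℝ) • h i)).integrable_norm_rpow hp0 hp).congr ?_
  filter_upwards [(Lp.isDisjointPositive_iff (E := Lp ℝ q ν)).1 hh, Lp.coeFn_sum_smul Finset.univ (fun _ => 1) h]
    with x h1 h2
  have h3 := Lp.norm_sum_rpow_of_isDisjointPositive hq h1 (fun _ => 1)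
  simp only [abs_one, Real.one_rpow, one_mul] at h3
  rw [h2, ← h3, ← Real.rpow_mul (norm_nonneg _), mul_div_cancel₀ _ hpos.ne']

end NormFormula

end

noncomputable section

/-! ### Measures on the simplex determined by integrals of `r`-th powers. -/

section Equimeasurability

/-- Repeated differentiation lowers the exponent past zero, so the dominating constant has to cover
both signs: one endpoint dominates for each. -/
theorem rpow_le_of_mem_Icc {z : ℝ} (h1 : 1 / 2 ≤ z) (h2 : z ≤ 3 / 2) (u : ℝ) :
    z ^ u ≤ (1 / 2 : ℝ) ^ u + (3 / 2 : ℝ) ^ u := by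
  rcases le_total 0 u with hu | hu
  · have := Real.rpow_le_rpow (by linarith) h2 hu
    have : (0 : ℝ) ≤ (1 / 2 : ℝ) ^ u := by positivity
    linarith
  · have := Real.rpow_le_rpow_of_nonpos (by norm_num) h1 hu
    have : (0 : ℝ) ≤ (3 / 2 : ℝ) ^ u := by positivity
    linarith

/-- For `|t| < 1/(2C)` the base stays away from zero, where real powers of every exponent are smooth
and bounded. -/
theorem one_add_mul_mem {C t y : ℝ} (hC : 0 < C) (hy : |y| ≤ C) (ht : |t| < 1 / (2 * C)) :
    1 / 2 ≤ 1 + t * y ∧ 1 + t * y ≤ 3 / 2 := by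
  have : |t * y| ≤ 1 / 2 := by
    rw [abs_mul]
    calc |t| * |y| ≤ 1 / (2 * C) * C := by gcongr
      _ = 1 / 2 := by field_simp
  have := abs_le.1 this
  constructor <;> linarith

variable {α : Type*} [MeasurableSpace α]

/-- Differentiation under the integral. The derivative has the same shape with `n + 1` and `u - 1`,
so the lemma can be iterated. -/
theorem hasDerivAt_integral_pow_mul_rpow {σ : Measure α} [IsFiniteMeasure σ] {y : α → ℝ}
    (hy : Measurable y) {C : ℝ} (hC : 0 < C) (hyC : ∀ᵐ x ∂σ, |y x| ≤ C) (n : ℕ) (u : ℝ) {t : ℝ}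
    (ht : |t| < 1 / (2 * C)) :
    HasDerivAt (fun t => ∫ x, y x ^ n * (1 + t * y x) ^ u ∂σ)
      (u * ∫ x, y x ^ (n + 1) * (1 + t * y x) ^ (u - 1) ∂σ) t := by
  have hm : ∀ (n : ℕ) (u t : ℝ), Measurable fun x => y x ^ n * (1 + t * y x) ^ u := by
    intro n u t
    exact (hy.pow_const n).mul ((measurable_const.add (hy.const_mul t)).pow_const u)
  have hb : ∀ (n : ℕ) (u t : ℝ), |t| < 1 / (2 * C) → ∀ᵐ x ∂σ,
      ‖y x ^ n * (1 + t * y x) ^ u‖ ≤ C ^ n * ((1 / 2 : ℝ) ^ u + (3 / 2 : ℝ) ^ u) := by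
    intro n u t ht
    filter_upwards [hyC] with x hx
    obtain ⟨h1, h2⟩ := one_add_mul_mem hC hx ht
    rw [norm_mul, norm_pow, Real.norm_eq_abs, Real.norm_eq_abs,
      abs_of_nonneg (Real.rpow_nonneg (by linarith) u)]
    exact mul_le_mul (pow_le_pow_left₀ (abs_nonneg _) hx n) (rpow_le_of_mem_Icc h1 h2 u)
      (Real.rpow_nonneg (by linarith) u) (by positivity)
  have hs : Metric.ball (0 : ℝ) (1 / (2 * C)) ∈ nhds t := by
    refine Metric.isOpen_ball.mem_nhds ?_
    simpa using ht
  have hF := hasDerivAt_integral_of_dominated_loc_of_deriv_le (μ := σ) (x₀ := t)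
    (F := fun t x => y x ^ n * (1 + t * y x) ^ u)
    (F' := fun t x => u * (y x ^ (n + 1) * (1 + t * y x) ^ (u - 1)))
    (bound := fun _ => |u| * (C ^ (n + 1) * ((1 / 2 : ℝ) ^ (u - 1) + (3 / 2 : ℝ) ^ (u - 1))))
    hs (Filter.Eventually.of_forall fun t => (hm n u t).aestronglyMeasurable)
    (Integrable.of_bound (hm n u t).aestronglyMeasurable _ (hb n u t ht))
    ((hm (n + 1) (u - 1) t).const_mul u).aestronglyMeasurable ?_ (integrable_const _) ?_
  · have := hF.2
    rwa [integral_const_mul] at this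
  · filter_upwards [hyC] with x hx s hs
    have hs' : |s| < 1 / (2 * C) := by simpa using hs
    obtain ⟨h1, h2⟩ := one_add_mul_mem hC hx hs'
    rw [norm_mul, norm_mul, norm_pow, Real.norm_eq_abs, Real.norm_eq_abs, Real.norm_eq_abs,
      abs_of_nonneg (Real.rpow_nonneg (by linarith) (u - 1))]
    refine mul_le_mul_of_nonneg_left ?_ (abs_nonneg u)
    exact mul_le_mul (pow_le_pow_left₀ (abs_nonneg _) hx _) (rpow_le_of_mem_Icc h1 h2 _)
      (Real.rpow_nonneg (by linarith) _) (by positivity)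
  · filter_upwards [hyC] with x hx s hs
    have hs' : |s| < 1 / (2 * C) := by simpa using hs
    obtain ⟨h1, h2⟩ := one_add_mul_mem hC hx hs'
    have hd : HasDerivAt (fun s => 1 + s * y x) (y x) s := by
      simpa using ((hasDerivAt_id s).mul_const (y x)).const_add 1
    refine ((hd.rpow_const (p := u) (Or.inl (by linarith))).const_mul (y x ^ n)).congr_deriv ?_
    ring

theorem moments_eq_of_integral_rpow_eq {σ τ : Measure α} [IsFiniteMeasure σ] [IsFiniteMeasure τ]
    {y : α → ℝ} (hy : Measurable y) {C : ℝ} (hC : 0 < C) (hσ : ∀ᵐ x ∂σ, |y x| ≤ C)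
    (hτ : ∀ᵐ x ∂τ, |y x| ≤ C) {r : ℝ} (hr : ∀ n : ℕ, r ≠ n)
    (h : ∀ t : ℝ, |t| < 1 / (2 * C) → ∫ x, (1 + t * y x) ^ r ∂σ = ∫ x, (1 + t * y x) ^ r ∂τ)
    (n : ℕ) : ∫ x, y x ^ n ∂σ = ∫ x, y x ^ n ∂τ := by
  -- Equality on a whole interval of `t`, not only at `0`, is what can be differentiated again.
  have key : ∀ n : ℕ, ∀ t : ℝ, |t| < 1 / (2 * C) →
      ∫ x, y x ^ n * (1 + t * y x) ^ (r - n) ∂σ = ∫ x, y x ^ n * (1 + t * y x) ^ (r - n) ∂τ := by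
    intro n
    induction n with
    | zero => simpa using h
    | succ n ih =>
      intro t ht
      have h1 := hasDerivAt_integral_pow_mul_rpow hy hC hσ n (r - n) ht
      have h2 := hasDerivAt_integral_pow_mul_rpow hy hC hτ n (r - n) ht
      have hs : Metric.ball (0 : ℝ) (1 / (2 * C)) ∈ nhds t := by
        refine Metric.isOpen_ball.mem_nhds ?_
        simpa using ht
      have h3 := h2.congr_of_eventuallyEq (f₁ := fun t => ∫ x, y x ^ n * (1 + t * y x) ^ (r - n) ∂σ)
        (by filter_upwards [hs] with s hs using ih s (by simpa using hs))
      have h4 := h1.unique h3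
      -- This is where the non-integrality of `r` is needed: the factor `r - n` can be cancelled.
      have h5 := mul_left_cancel₀ (sub_ne_zero.2 (hr n)) h4
      push_cast
      rwa [← sub_sub]
  simpa using key n 0 (by simpa using hC)

/-- Since `y` is bounded and the measures are finite, the exponential series integrates term by
term, and the terms are moments. -/
theorem integral_cexp_eq_of_moments_eq {σ τ : Measure α} [IsFiniteMeasure σ] [IsFiniteMeasure τ]
    {y : α → ℝ} (hy : Measurable y) {C : ℝ} (hσ : ∀ᵐ x ∂σ, |y x| ≤ C)
    (hτ : ∀ᵐ x ∂τ, |y x| ≤ C) (h : ∀ n : ℕ, ∫ x, y x ^ n ∂σ = ∫ x, y x ^ n ∂τ) :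
    ∫ x, Complex.exp (y x * Complex.I) ∂σ = ∫ x, Complex.exp (y x * Complex.I) ∂τ := by
  have key : ∀ ρ : Measure α, IsFiniteMeasure ρ → (∀ᵐ x ∂ρ, |y x| ≤ C) →
      HasSum (fun n : ℕ => Complex.I ^ n / (n.factorial : ℂ) * ((∫ x, y x ^ n ∂ρ : ℝ) : ℂ))
        (∫ x, Complex.exp (y x * Complex.I) ∂ρ) := by
    intro ρ _ hρ
    have hb : ∀ n : ℕ, ∀ᵐ x ∂ρ, ‖((y x : ℂ) * Complex.I) ^ n / (n.factorial : ℂ)‖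
        ≤ C ^ n / n.factorial := by
      intro n
      filter_upwards [hρ] with x hx
      simp only [norm_div, norm_pow, norm_mul, Complex.norm_I, mul_one, Complex.norm_real,
        Complex.norm_natCast, Real.norm_eq_abs]
      gcongr
    have hm : ∀ n : ℕ, Measurable fun x => ((y x : ℂ) * Complex.I) ^ n / (n.factorial : ℂ) :=
      fun n => (((Complex.measurable_ofReal.comp hy).mul_const _).pow_const n).div_const _
    have hi : ∀ n : ℕ, Integrable (fun x => ((y x : ℂ) * Complex.I) ^ n / (n.factorial : ℂ)) ρ :=
      fun n => Integrable.of_bound (hm n).aestronglyMeasurable _ (hb n)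
    have h1 := hasSum_integral_of_summable_integral_norm hi (by
      refine Summable.of_nonneg_of_le (fun n => integral_nonneg fun x => norm_nonneg _)
        (fun n => ?_) ((Real.summable_pow_div_factorial C).mul_left (ρ.real Set.univ))
      calc ∫ x, ‖((y x : ℂ) * Complex.I) ^ n / (n.factorial : ℂ)‖ ∂ρ
          ≤ ∫ _, C ^ n / n.factorial ∂ρ := integral_mono_ae (hi n).norm (integrable_const _) (hb n)
        _ = _ := by simp)
    have h2 : ∀ n : ℕ, ∫ x, ((y x : ℂ) * Complex.I) ^ n / (n.factorial : ℂ) ∂ρ =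
        Complex.I ^ n / (n.factorial : ℂ) * ((∫ x, y x ^ n ∂ρ : ℝ) : ℂ) := by
      intro n
      have h3 : ((∫ x, y x ^ n ∂ρ : ℝ) : ℂ) = ∫ x, ((y x ^ n : ℝ) : ℂ) ∂ρ :=
        integral_ofReal.symm
      rw [h3, ← integral_const_mul]
      congr 1
      funext x
      simp only [mul_pow, Complex.ofReal_pow]
      ring
    simp only [h2] at h1
    have h4 : ∫ x, Complex.exp (y x * Complex.I) ∂ρ =
        ∫ x, ∑' n : ℕ, ((y x : ℂ) * Complex.I) ^ n / (n.factorial : ℂ) ∂ρ := by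
      refine integral_congr_ae (Filter.Eventually.of_forall fun x => ?_)
      simp only [Complex.exp_eq_exp_ℂ, NormedSpace.exp_eq_tsum_div]
    rwa [h4]
  have h1 := key σ inferInstance hσ
  have h2 := key τ inferInstance hτ
  simp only [h] at h1
  exact h1.unique h2

/-- Equimeasurability: for a non-integral exponent `r`, a finite measure on the standard simplex
is determined by the integrals of the `r`-th powers of the nonnegative linear forms. -/
theorem measure_eq_of_integral_rpow_eq {m : ℕ} {σ τ : Measure (Fin m → ℝ)} [IsFiniteMeasure σ]
    [IsFiniteMeasure τ] (hσ : ∀ᵐ x ∂σ, (∀ j, 0 ≤ x j) ∧ ∑ j, x j = 1)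
    (hτ : ∀ᵐ x ∂τ, (∀ j, 0 ≤ x j) ∧ ∑ j, x j = 1) {r : ℝ} (hr : ∀ n : ℕ, r ≠ n)
    (h : ∀ b : Fin m → ℝ, (∀ j, 0 ≤ b j) →
      ∫ x, (∑ j, b j * x j) ^ r ∂σ = ∫ x, (∑ j, b j * x j) ^ r ∂τ) : σ = τ := by
  refine Measure.ext_of_charFunDual ?_
  ext L
  rw [charFunDual_apply, charFunDual_apply]
  set c : Fin m → ℝ := fun j => L (Pi.single j 1) with hc
  have hL : ∀ x, L x = ∑ j, c j * x j := by
    intro x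
    conv_lhs => rw [← Finset.univ_sum_single x]
    rw [map_sum]
    refine Finset.sum_congr rfl fun j _ => ?_
    have : (Pi.single j (x j) : Fin m → ℝ) = x j • Pi.single j 1 := by
      rw [← Pi.single_smul, smul_eq_mul, mul_one]
    rw [this, map_smul, smul_eq_mul, mul_comm]
  -- The summand `1` keeps `C` positive even when `L` vanishes. `C` bounds both `L` on the simplex
  -- and each coefficient.
  set C : ℝ := ∑ j, |c j| + 1 with hCdef
  have hC : 0 < C := by positivity
  have hcC : ∀ j, |c j| ≤ C := fun j => by
    have := Finset.single_le_sum (f := fun j => |c j|) (fun i _ => abs_nonneg _)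
      (Finset.mem_univ j)
    linarith
  have hbound : ∀ x : Fin m → ℝ, ((∀ j, 0 ≤ x j) ∧ ∑ j, x j = 1) → |L x| ≤ C := by
    rintro x ⟨hx0, hx1⟩
    rw [hL]
    calc |∑ j, c j * x j| ≤ ∑ j, |c j * x j| := Finset.abs_sum_le_sum_abs _ _
      _ ≤ ∑ j, C * x j := by
        refine Finset.sum_le_sum fun j _ => ?_
        rw [abs_mul, abs_of_nonneg (hx0 j)]
        exact mul_le_mul_of_nonneg_right (hcC j) (hx0 j)
      _ = C := by rw [← Finset.mul_sum, hx1, mul_one]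
  have hLm : Measurable fun x => L x := L.continuous.measurable
  refine integral_cexp_eq_of_moments_eq hLm (hσ.mono hbound) (hτ.mono hbound) fun n => ?_
  refine moments_eq_of_integral_rpow_eq hLm hC (hσ.mono hbound) (hτ.mono hbound) hr ?_ n
  intro t ht
  have hb : ∀ j, 0 ≤ 1 + t * c j := fun j => by
    have := (one_add_mul_mem hC (hcC j) ht).1
    linarith
  -- On the simplex `∑ x j = 1`, so the affine function `1 + t * L x` is a linear form; its
  -- coefficients are nonnegative for small `t`.
  have heq : ∀ x : Fin m → ℝ, ((∀ j, 0 ≤ x j) ∧ ∑ j, x j = 1) →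
      (1 + t * L x) ^ r = (∑ j, (1 + t * c j) * x j) ^ r := by
    rintro x ⟨-, hx1⟩
    congr 1
    simp only [add_mul, one_mul, Finset.sum_add_distrib, hx1, mul_assoc, ← Finset.mul_sum, hL]
  rw [integral_congr_ae (hσ.mono heq), integral_congr_ae (hτ.mono heq)]
  exact h _ hb

end Equimeasurability

end

noncomputable section

/-! ### The fibre profile and its distribution. -/

section Profile

variable {Ω Ω' : Type*} [MeasurableSpace Ω] [MeasurableSpace Ω'] {p q : ℝ≥0∞}
  [Fact (1 ≤ q)] {μ : Measure Ω} {ν : Measure Ω'} {m : ℕ}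

/-- The sum of the `q`-th powers of the fibre norms of a finite family. -/
def fibreMass (h : Fin m → MixedLp p q μ ν) (ω : Ω) : ℝ := ∑ j, ‖h j ω‖ ^ q.toReal

/-- The normalized vector of `q`-th powers of the fibre norms of a finite family. -/
def fibreProfile (h : Fin m → MixedLp p q μ ν) (ω : Ω) : Fin m → ℝ :=
  fun j => ‖h j ω‖ ^ q.toReal / fibreMass h ω

/-- The distribution of the fibre profile, weighted by the `p`-th power of the fibre norm of the
sum of the family. -/
def profileMeasure (h : Fin m → MixedLp p q μ ν) : Measure (Fin m → ℝ) :=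
  (μ.withDensity fun ω => ENNReal.ofReal (fibreMass h ω ^ (p.toReal / q.toReal))).map
    (fibreProfile h)

variable (h : Fin m → MixedLp p q μ ν)

theorem fibreMass_nonneg (ω : Ω) : 0 ≤ fibreMass h ω :=
  Finset.sum_nonneg fun _ _ => by positivity

theorem measurable_fibreNorm (j : Fin m) : Measurable fun ω => ‖h j ω‖ ^ q.toReal :=
  (Lp.stronglyMeasurable (h j)).norm.measurable.pow_const _

theorem measurable_fibreMass : Measurable (fibreMass h) :=
  Finset.measurable_sum _ fun j _ => measurable_fibreNorm h j

theorem measurable_fibreProfile : Measurable (fibreProfile h) :=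
  measurable_pi_lambda _ fun j => (measurable_fibreNorm h j).div (measurable_fibreMass h)

theorem measurable_profileDensity :
    Measurable fun ω => ENNReal.ofReal (fibreMass h ω ^ (p.toReal / q.toReal)) :=
  ((measurable_fibreMass h).pow_const _).ennreal_ofReal

variable {h}

theorem fibreNorm_rpow_eq_zero {ω : Ω} (h0 : fibreMass h ω = 0) (j : Fin m) :
    ‖h j ω‖ ^ q.toReal = 0 :=
  (Finset.sum_eq_zero_iff_of_nonneg fun _ _ => by positivity).1 h0 j (Finset.mem_univ j)

/-- Valid also where the mass is zero, since all fibre norms vanish there. -/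
theorem fibreProfile_mul_fibreMass (ω : Ω) (j : Fin m) :
    fibreProfile h ω j * fibreMass h ω = ‖h j ω‖ ^ q.toReal := by
  by_cases h0 : fibreMass h ω = 0
  · rw [h0, mul_zero, fibreNorm_rpow_eq_zero h0]
  · exact div_mul_cancel₀ _ h0

variable [Fact (1 ≤ p)]

theorem profileExponent_pos (hp : p ≠ ∞) (hq : q ≠ ∞) : 0 < p.toReal / q.toReal :=
  div_pos (toReal_pos_of_fact hp) (toReal_pos_of_fact hq)

/-- The exponent `p/q` is positive, so the density vanishes exactly where the mass does. -/
theorem ae_profileDensity_iff (hp : p ≠ ∞) (hq : q ≠ ∞) {P : Ω → Prop} :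
    (∀ᵐ ω ∂(μ.withDensity fun ω => ENNReal.ofReal (fibreMass h ω ^ (p.toReal / q.toReal))), P ω) ↔
      ∀ᵐ ω ∂μ, fibreMass h ω ≠ 0 → P ω := by
  rw [ae_withDensity_iff (measurable_profileDensity h)]
  refine Filter.eventually_congr (Filter.Eventually.of_forall fun ω => ?_)
  refine imp_congr_left (not_congr ?_)
  rw [ENNReal.ofReal_eq_zero]
  constructor
  · intro h1
    exact ((Real.rpow_eq_zero_iff_of_nonneg (fibreMass_nonneg h ω)).1
      (le_antisymm h1 (Real.rpow_nonneg (fibreMass_nonneg h ω) _))).1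
  · intro h1
    rw [h1, Real.zero_rpow (profileExponent_pos hp hq).ne']

theorem ae_profileMeasure_iff (hp : p ≠ ∞) (hq : q ≠ ∞) {P : (Fin m → ℝ) → Prop}
    (hP : MeasurableSet {x | P x}) :
    (∀ᵐ x ∂(profileMeasure h), P x) ↔ ∀ᵐ ω ∂μ, fibreMass h ω ≠ 0 → P (fibreProfile h ω) := by
  rw [profileMeasure, ae_map_iff (measurable_fibreProfile h).aemeasurable hP,
    ae_profileDensity_iff hp hq]

theorem ae_profileMeasure_mem_simplex (hp : p ≠ ∞) (hq : q ≠ ∞) :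
    ∀ᵐ x ∂(profileMeasure h), (∀ j, 0 ≤ x j) ∧ ∑ j, x j = 1 := by
  rw [ae_profileMeasure_iff hp hq]
  · refine Filter.Eventually.of_forall fun ω hω => ⟨fun j => ?_, ?_⟩
    · exact div_nonneg (by positivity) (fibreMass_nonneg h ω)
    · simp only [fibreProfile]
      rw [← Finset.sum_div]
      exact div_self hω
  · refine MeasurableSet.inter ?_ ?_
    · exact MeasurableSet.congr (s := ⋂ j, {x : Fin m → ℝ | 0 ≤ x j})
        (MeasurableSet.iInter fun j => measurableSet_le measurable_const (measurable_pi_apply j))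
        (by ext; simp only [Set.mem_iInter]; rfl)
    · exact measurableSet_eq_fun (Finset.measurable_sum _ fun j _ => measurable_pi_apply j)
        measurable_const

theorem isFiniteMeasure_profileMeasure (hp : p ≠ ∞) (hq : q ≠ ∞) (hh : IsDisjointPositive h) :
    IsFiniteMeasure (profileMeasure h) := by
  have : IsFiniteMeasure
      (μ.withDensity fun ω => ENNReal.ofReal (fibreMass h ω ^ (p.toReal / q.toReal))) :=
    isFiniteMeasure_withDensity_ofReal (MixedLp.integrable_rpow_sum hp hq hh).2
  exact Measure.isFiniteMeasure_map _ _

/-- By homogeneity the density `M^r` turns `(∑ b j * x j)^r` into `(∑ b j * ‖h j ω‖^q)^r`, the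
integrand of the norm formula; the root `b j ^ (1/q)` undoes the `q`-th power there. -/
theorem integral_profileMeasure (hp : p ≠ ∞) (hq : q ≠ ∞) (hh : IsDisjointPositive h)
    {b : Fin m → ℝ} (hb : ∀ j, 0 ≤ b j) :
    ∫ x, (∑ j, b j * x j) ^ (p.toReal / q.toReal) ∂(profileMeasure h) =
      ‖∑ j, (b j ^ q.toReal⁻¹) • h j‖ ^ p.toReal := by
  have hr := profileExponent_pos hp hq (p := p) (q := q)
  rw [profileMeasure, integral_map (measurable_fibreProfile h).aemeasurable]
  · rw [integral_withDensity_eq_integral_toReal_smul (measurable_profileDensity h)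
      (Filter.Eventually.of_forall fun _ => ENNReal.ofReal_lt_top), MixedLp.norm_sum_rpow hp hq hh]
    refine integral_congr_ae (Filter.Eventually.of_forall fun ω => ?_)
    have hm := fibreMass_nonneg h ω
    have h0 : 0 ≤ ∑ j, b j * fibreProfile h ω j :=
      Finset.sum_nonneg fun j _ => mul_nonneg (hb j) (div_nonneg (by positivity) hm)
    simp only
    rw [ENNReal.toReal_ofReal (Real.rpow_nonneg hm _), smul_eq_mul, ← Real.mul_rpow hm h0,
      Finset.mul_sum]
    congr 1
    refine Finset.sum_congr rfl fun j _ => ?_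
    rw [← fibreProfile_mul_fibreMass, abs_of_nonneg (Real.rpow_nonneg (hb j) _),
      Real.rpow_inv_rpow (hb j) (toReal_pos_of_fact hq).ne']
    ring
  · have hm : Measurable fun x : Fin m → ℝ => ∑ j, b j * x j := by fun_prop
    exact (hm.pow_const _).aestronglyMeasurable

/-- When `p / q` is not an integer, the norms of the combinations of a disjoint positive family
determine its profile measure. -/
theorem profileMeasure_eq_of_norm_eq {Ω₁ Ω₁' : Type*} [MeasurableSpace Ω₁] [MeasurableSpace Ω₁']
    {μ₁ : Measure Ω₁} {ν₁ : Measure Ω₁'} {h₁ : Fin m → MixedLp p q μ₁ ν₁}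
    (hp : p ≠ ∞) (hq : q ≠ ∞) (hpq : ∀ n : ℕ, p / q ≠ (n : ℝ≥0∞)) (hh : IsDisjointPositive h)
    (hh₁ : IsDisjointPositive h₁)
    (hnorm : ∀ a : Fin m → ℝ, ‖∑ j, a j • h j‖ = ‖∑ j, a j • h₁ j‖) :
    profileMeasure h = profileMeasure h₁ := by
  have := isFiniteMeasure_profileMeasure hp hq hh
  have := isFiniteMeasure_profileMeasure hp hq hh₁
  refine measure_eq_of_integral_rpow_eq (ae_profileMeasure_mem_simplex hp hq)
    (ae_profileMeasure_mem_simplex hp hq) (r := p.toReal / q.toReal) (fun n hn => ?_)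
    fun b hb => ?_
  · have hq0 : q ≠ 0 := (zero_lt_one.trans_le (Fact.out : 1 ≤ q)).ne'
    refine hpq n ?_
    rw [← ENNReal.toReal_div] at hn
    rw [← ENNReal.ofReal_toReal (ENNReal.div_ne_top hp hq0), hn, ENNReal.ofReal_natCast]
  · rw [integral_profileMeasure hp hq hh hb, integral_profileMeasure hp hq hh₁ hb, hnorm]

/-- The profile measure of a family in a finite-dimensional solid subspace is concentrated on a
finite set. -/
theorem exists_finset_profileMeasure_compl_eq_zero (hp : p ≠ ∞) (hq : q ≠ ∞)
    (hh : IsDisjointPositive h) (S : Submodule ℝ (MixedLp p q μ ν)) [FiniteDimensional ℝ S]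
    (hS : ∀ x y : MixedLp p q μ ν, y ∈ S → |x| ≤ |y| → x ∈ S) (hhS : ∀ j, h j ∈ S) :
    ∃ K : Finset (Fin m → ℝ), profileMeasure h (K : Set (Fin m → ℝ))ᶜ = 0 := by
  classical
  suffices hfin : (profileMeasure h).support.Finite by
    refine ⟨hfin.toFinset, ?_⟩
    rw [hfin.coe_toFinset]
    exact Measure.measure_compl_support
  by_contra hinf
  -- An infinite support would contain more points than the dimension of `S`. Disjoint
  -- neighbourhoods of these yield too many independent elements of `S`.
  obtain ⟨T, hTsub, hTcard⟩ :=
    (Set.not_finite.1 hinf).exists_subset_card_eq (Module.finrank ℝ S + 1)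
  obtain ⟨U, hU, hUd⟩ := T.finite_toSet.t2_separation
  have hA : ∀ x : T, MeasurableSet (fibreProfile h ⁻¹' U x) :=
    fun x => measurable_fibreProfile h (hU x).2.measurableSet
  set s : MixedLp p q μ ν := ∑ j, h j with hs
  have hspos : 0 ≤ s := Finset.sum_nonneg fun j _ => hh.1 j
  have hsS : s ∈ S := Submodule.sum_mem _ fun j _ => hhS j
  -- Cutting `s` down to the `ω` whose profile lies in `U x` stays inside `S` by solidity.
  let g : T → MixedLp p q μ ν := fun x => Lp.restrictTo (hA x) s
  have hsω : ∀ᵐ ω ∂μ, 0 ≤ s ω := (Lp.coeFn_nonneg s).2 hspos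
  have hgS : ∀ x, g x ∈ S := by
    intro x
    refine hS _ s hsS ?_
    rw [← Lp.coeFn_le]
    filter_upwards [Lp.coeFn_abs (g x), Lp.coeFn_abs s, Lp.coeFn_restrictTo (hA x) s]
      with ω h1 h2 h3
    rw [h1, h2, h3]
    by_cases hω : ω ∈ fibreProfile h ⁻¹' U x
    · rw [Set.indicator_of_mem hω]
    · rw [Set.indicator_of_notMem hω, abs_zero]
      exact abs_nonneg _
  have hgd : IsDisjointPositive g := by
    rw [Lp.isDisjointPositive_iff (E := Lp ℝ q ν)]
    filter_upwards [hsω, ae_all_iff.2 fun x => Lp.coeFn_restrictTo (hA x) s] with ω h1 h2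
    have h3 : ∀ x, 0 ≤ g x ω := fun x => by
      simp only [g, h2 x]
      exact Set.indicator_apply_nonneg fun _ => h1
    refine ⟨h3, fun x y hxy => ?_⟩
    have hd := hUd x.2 y.2 (fun e => hxy (Subtype.ext e))
    by_cases hω : ω ∈ fibreProfile h ⁻¹' U x
    · have : ω ∉ fibreProfile h ⁻¹' U y := fun hy => Set.disjoint_left.1 hd hω hy
      have h4 : g y ω = 0 := by simp only [g, h2 y, Set.indicator_of_notMem this]
      simp only [h4]
      exact inf_eq_right.2 (h3 x)
    · have h4 : g x ω = 0 := by simp only [g, h2 x, Set.indicator_of_notMem hω]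
      simp only [h4]
      exact inf_eq_left.2 (h3 y)
  have hgne : ∀ x, g x ≠ 0 := by
    intro x hx
    have hpos := (Measure.mem_support_iff_forall _).1 (hTsub x.2) _ ((hU x).2.mem_nhds (hU x).1)
    refine hpos.ne' ?_
    -- If `g x = 0`, then `s`, and with it the fibre mass, vanishes a.e. where the profile is in `U
    -- x`. This neighbourhood of a support point would then be null.
    have : ∀ᵐ y ∂(profileMeasure h), y ∉ U x := by
      rw [ae_profileMeasure_iff hp hq (hU x).2.measurableSet.compl]
      filter_upwards [(Lp.eq_zero_iff_ae_eq_zero).1 hx, Lp.coeFn_restrictTo (hA x) s,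
        Lp.coeFn_sum_smul Finset.univ (fun _ => 1) h,
        (Lp.isDisjointPositive_iff (E := Lp ℝ q ν)).1 hh] with ω h1 h2 h3 h4 hω hmem
      refine hω ?_
      have h5 := Lp.norm_sum_rpow_of_isDisjointPositive hq h4 (fun _ => 1)
      simp only [one_smul] at h3
      simp only [abs_one, Real.one_rpow, one_mul, one_smul] at h5
      rw [fibreMass, ← h5, ← h3]
      rw [h1, Set.indicator_of_mem (show ω ∈ fibreProfile h ⁻¹' U x from hmem)] at h2
      rw [← hs, ← h2]
      simp [Real.zero_rpow (toReal_pos_of_fact hq).ne']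
    simpa [ae_iff] using this
  have hli : LinearIndependent ℝ fun x : T => (⟨g x, hgS x⟩ : S) := by
    rw [Fintype.linearIndependent_iff]
    intro a ha
    refine hgd.eq_zero_of_sum_eq_zero hgne ?_
    simpa using congrArg Subtype.val ha
  have := hli.fintype_card_le_finrank
  simp [hTcard] at this

end Profile

end

/-! ### Splitting along the level sets of the profile. -/

noncomputable section

/-- The linear combinations of a family indexed by pairs have the norm of an `ℓ_p`-sum of `ℓ_q`
spaces, the first index numbering the summands. -/
def HasRowBlockNorm (p q : ℝ≥0∞) {X : Type*} [NormedAddCommGroup X] [NormedSpace ℝ X] {m L : ℕ}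
    (I : Finset (Fin L × Fin m)) (φ : I → X) : Prop :=
  ∀ a : I → ℝ, ‖∑ i : I, a i • φ i‖ ^ p.toReal =
    ∑ k : Fin L, (∑ i : I with i.1.1 = k, |a i| ^ q.toReal) ^ (p.toReal / q.toReal)

/-- The norm of the component of the `j`-th member of a family on the set where the fibre profile
is `x`, in terms of the mass `t` of `x`. -/
def atomWeight (p q : ℝ≥0∞) {m : ℕ} (t : ℝ) (x : Fin m → ℝ) (j : Fin m) : ℝ :=
  x j ^ q.toReal⁻¹ * t ^ p.toReal⁻¹

theorem atomWeight_rpow {p q : ℝ≥0∞} [Fact (1 ≤ q)] {m : ℕ} (hq : q ≠ ∞) {t : ℝ} (ht : 0 ≤ t) {x : Fin m → ℝ} {j : Fin m}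
    (hx : 0 ≤ x j) : atomWeight p q t x j ^ q.toReal = x j * t ^ (q.toReal / p.toReal) := by
  rw [atomWeight, Real.mul_rpow (by positivity) (by positivity),
    Real.rpow_inv_rpow hx (toReal_pos_of_fact hq).ne', ← Real.rpow_mul ht]
  congr 2
  ring

/-- At most one row satisfies `P`, so the power acts on a single row sum, or on zero. -/
theorem sum_ite_rpow {L : ℕ} {ι : Type*} [Fintype ι] (row : ι → Fin L) (b : ι → ℝ) {r : ℝ} (hr : r ≠ 0)
    (P : Fin L → Prop) [DecidablePred P] (hP : ∀ k l, P k → P l → k = l) :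
    (∑ i, if P (row i) then b i else 0) ^ r =
      ∑ k, if P k then (∑ i with row i = k, b i) ^ r else 0 := by
  by_cases h : ∃ k, P k
  · obtain ⟨k, hk⟩ := h
    have hiff : ∀ l, P l ↔ l = k := fun l => ⟨fun hl => hP l k hl hk, fun e => e ▸ hk⟩
    simp only [hiff, Finset.sum_ite_eq', Finset.mem_univ, if_true, Finset.sum_filter]
  · push Not at h
    simp [h, Real.zero_rpow hr]

section Decomposition

variable {Ω Ω' : Type*} [MeasurableSpace Ω] [MeasurableSpace Ω'] {p q : ℝ≥0∞}
  [Fact (1 ≤ q)] {μ : Measure Ω} {ν : Measure Ω'} {m L : ℕ}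

theorem measureReal_profileMeasure_singleton
    (h : Fin m → MixedLp p q μ ν) (x : Fin m → ℝ) :
    (profileMeasure h).real {x} =
      ∫ ω in fibreProfile h ⁻¹' {x}, fibreMass h ω ^ (p.toReal / q.toReal) ∂μ := by
  have hA : MeasurableSet (fibreProfile h ⁻¹' {x}) :=
    measurable_fibreProfile h (measurableSet_singleton x)
  rw [measureReal_def, profileMeasure,
    Measure.map_apply (measurable_fibreProfile h) (measurableSet_singleton x),
    withDensity_apply _ hA, integral_eq_lintegral_of_nonneg_ae]
  · exact Filter.Eventually.of_forall fun ω => Real.rpow_nonneg (fibreMass_nonneg h ω) _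
  · exact ((measurable_fibreMass h).pow_const _).aestronglyMeasurable

variable [Fact (1 ≤ p)]

/-- A disjoint positive family whose profile measure is concentrated on finitely many points
splits along the level sets of the fibre profile into the normalized atoms of an `ℓ_p`-sum of
`ℓ_q` spaces; the coefficients depend only on the profile measure. -/
theorem exists_rowBlock_decomposition (hp : p ≠ ∞) (hq : q ≠ ∞) {h : Fin m → MixedLp p q μ ν}
    (hh : IsDisjointPositive h) {x : Fin L → Fin m → ℝ} (hinj : Function.Injective x)
    (hpos : ∀ k, profileMeasure h {x k} ≠ 0) (hae : ∀ᵐ y ∂(profileMeasure h), ∃ k, y = x k)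
    {I : Finset (Fin L × Fin m)} (hI : ∀ i, i ∈ I ↔ x i.1 i.2 ≠ 0) :
    ∃ φ : I → MixedLp p q μ ν, IsDisjointPositive φ ∧ HasRowBlockNorm p q I φ ∧
      ∀ j, h j = ∑ i : I with i.1.2 = j,
        atomWeight p q ((profileMeasure h).real {x i.1.1}) (x i.1.1) i.1.2 • φ i := by
  classical
  have hfm := isFiniteMeasure_profileMeasure hp hq hh
  have hp' := toReal_pos_of_fact hp
  have hq' := toReal_pos_of_fact hq
  have hr : p.toReal / q.toReal ≠ 0 := (div_pos hp' hq').ne'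
  set t : Fin L → ℝ := fun k => (profileMeasure h).real {x k} with ht
  have htpos : ∀ k, 0 < t k := fun k => ENNReal.toReal_pos (hpos k) (measure_ne_top _ _)
  -- A point of positive mass must lie in the simplex.
  have hx0 : ∀ k j, 0 ≤ x k j := by
    intro k
    by_contra hneg
    refine hpos k (measure_mono_null ?_ (ae_iff.1 (ae_profileMeasure_mem_simplex (h := h) hp hq)))
    rintro y rfl hy
    exact hneg hy.1
  have hxpos : ∀ i : I, 0 < x i.1.1 i.1.2 := fun i =>
    lt_of_le_of_ne (hx0 _ _) (Ne.symm ((hI i.1).1 i.2))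
  have hA : ∀ k, MeasurableSet (fibreProfile h ⁻¹' {x k}) :=
    fun k => measurable_fibreProfile h (measurableSet_singleton _)
  set c : I → ℝ := fun i => atomWeight p q (t i.1.1) (x i.1.1) i.1.2 with hc
  have hcpos : ∀ i, 0 < c i := fun i =>
    mul_pos (Real.rpow_pos_of_pos (hxpos i) _) (Real.rpow_pos_of_pos (htpos _) _)
  set φ : I → MixedLp p q μ ν := fun i => (c i)⁻¹ • Lp.restrictTo (hA i.1.1) (h i.1.2) with hφ
  have hφω : ∀ᵐ ω ∂μ, ∀ i, φ i ω =
      if fibreProfile h ω = x i.1.1 then (c i)⁻¹ • h i.1.2 ω else 0 := by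
    refine ae_all_iff.2 fun i => ?_
    filter_upwards [Lp.coeFn_smul (c i)⁻¹ (Lp.restrictTo (hA i.1.1) (h i.1.2)),
      Lp.coeFn_restrictTo (hA i.1.1) (h i.1.2)] with ω h1 h2
    rw [h1, Pi.smul_apply, h2, Set.indicator_apply]
    simp only [Set.mem_preimage, Set.mem_singleton_iff, smul_ite, smul_zero]
  have hφd : IsDisjointPositive φ := by
    rw [Lp.isDisjointPositive_iff (E := Lp ℝ q ν)]
    filter_upwards [hφω, (Lp.isDisjointPositive_iff (E := Lp ℝ q ν)).1 hh] with ω h1 h2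
    have hpos' : ∀ i : I, 0 ≤ (c i)⁻¹ • h i.1.2 ω := fun i =>
      smul_nonneg (inv_nonneg.2 (hcpos i).le) (h2.1 _)
    have hnn : ∀ i : I, 0 ≤ φ i ω := by
      intro i
      rw [h1]
      split_ifs
      exacts [hpos' i, le_rfl]
    refine ⟨hnn, fun i i' hii => ?_⟩
    by_cases hi : fibreProfile h ω = x i.1.1
    · by_cases hi' : fibreProfile h ω = x i'.1.1
      · have hne : i.1.2 ≠ i'.1.2 := fun e =>
          hii (Subtype.ext (Prod.ext (hinj (hi.symm.trans hi')) e))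
        simp only [h1, if_pos hi, if_pos hi']
        refine inf_smul_eq_zero (hpos' i) (h2.1 _) ?_ (inv_nonneg.2 (hcpos i').le)
        rw [inf_comm]
        refine inf_smul_eq_zero (h2.1 _) (h2.1 _) ?_ (inv_nonneg.2 (hcpos i).le)
        exact h2.2 _ _ hne.symm
      · have : φ i' ω = 0 := by rw [h1, if_neg hi']
        simp only [this]
        exact inf_eq_right.2 (hnn i)
    · have : φ i ω = 0 := by rw [h1, if_neg hi]
      simp only [this]
      exact inf_eq_left.2 (hnn i')
  refine ⟨φ, hφd, fun a => ?_, fun j => ?_⟩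
  · rw [MixedLp.norm_sum_rpow hp hq hφd]
    have hterm : ∀ᵐ ω ∂μ,
        (∑ i, |a i| ^ q.toReal * ‖φ i ω‖ ^ q.toReal) ^ (p.toReal / q.toReal) =
        ∑ k, ((∑ i : I with i.1.1 = k, |a i| ^ q.toReal) ^ (p.toReal / q.toReal) * (t k)⁻¹) *
          (fibreProfile h ⁻¹' {x k}).indicator
            (fun ω => fibreMass h ω ^ (p.toReal / q.toReal)) ω := by
      filter_upwards [hφω] with ω h1
      have hm := fibreMass_nonneg h ω
      -- Normalizing cancels the factor `x k j`: on the `k`-th level set `‖φ(k,j) ω‖^q` is the same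
      -- for every `j`. This makes the row an `ℓ_q` block.
      have h2 : ∀ i : I, |a i| ^ q.toReal * ‖φ i ω‖ ^ q.toReal =
          if fibreProfile h ω = x i.1.1 then
            |a i| ^ q.toReal * (fibreMass h ω * t i.1.1 ^ (-(q.toReal / p.toReal))) else 0 := by
        intro i
        rw [h1]
        split_ifs with hi
        · rw [norm_smul, norm_inv, Real.norm_of_nonneg (hcpos i).le,
            Real.mul_rpow (inv_nonneg.2 (hcpos i).le) (norm_nonneg _),
            Real.inv_rpow (hcpos i).le, atomWeight_rpow hq (htpos _).le (hx0 _ _),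
            ← fibreProfile_mul_fibreMass, hi, Real.rpow_neg (htpos _).le]
          have := (hxpos i).ne'
          have := (Real.rpow_pos_of_pos (htpos i.1.1) (q.toReal / p.toReal)).ne'
          field_simp
        · rw [norm_zero, Real.zero_rpow hq'.ne', mul_zero]
      simp only [h2]
      rw [sum_ite_rpow (fun i : I => i.1.1) _ hr (fun k => fibreProfile h ω = x k)
        fun k l hk hl => hinj (hk.symm.trans hl)]
      refine Finset.sum_congr rfl fun k _ => ?_
      rw [Set.indicator_apply]
      simp only [Set.mem_preimage, Set.mem_singleton_iff, mul_ite, mul_zero]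
      split_ifs with hk
      · have h3 : ∑ i : I with i.1.1 = k,
            |a i| ^ q.toReal * (fibreMass h ω * t i.1.1 ^ (-(q.toReal / p.toReal))) =
            (∑ i : I with i.1.1 = k, |a i| ^ q.toReal) *
              (fibreMass h ω * t k ^ (-(q.toReal / p.toReal))) := by
          rw [Finset.sum_mul]
          refine Finset.sum_congr rfl fun i hi => ?_
          rw [(Finset.mem_filter.1 hi).2]
        have h4 : 0 ≤ ∑ i : I with i.1.1 = k, |a i| ^ q.toReal :=
          Finset.sum_nonneg fun _ _ => by positivity
        have h5 := (Real.rpow_pos_of_pos (htpos k) (-(q.toReal / p.toReal))).le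
        rw [h3, Real.mul_rpow h4 (mul_nonneg hm h5), Real.mul_rpow hm h5,
          ← Real.rpow_mul (htpos k).le]
        -- The factor becomes `(t k)⁻¹`, which cancels the integral `t k` of `M^r` over the level
        -- set.
        have h6 : -(q.toReal / p.toReal) * (p.toReal / q.toReal) = -1 := by
          field_simp
        rw [h6, Real.rpow_neg_one]
        ring
      · rfl
    rw [integral_congr_ae hterm, integral_finsetSum]
    · refine Finset.sum_congr rfl fun k _ => ?_
      rw [integral_const_mul, integral_indicator (hA k),
        ← measureReal_profileMeasure_singleton, mul_assoc,
        inv_mul_cancel₀ (htpos k).ne', mul_one]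
    · exact fun k _ => ((MixedLp.integrable_rpow_sum hp hq hh).indicator (hA k)).const_mul _
  · rw [ae_profileMeasure_iff hp hq] at hae
    · refine Lp.ext ?_
      filter_upwards [hae, hφω, Lp.coeFn_sum_smul (Finset.univ.filter fun i : I => i.1.2 = j) c φ]
        with ω h1 h2 h3
      rw [h3]
      have h4 : ∀ i ∈ Finset.univ.filter (fun i : I => i.1.2 = j), c i • φ i ω =
          if fibreProfile h ω = x i.1.1 then h j ω else 0 := by
        intro i hi
        rw [h2, ← (Finset.mem_filter.1 hi).2]
        split_ifs
        · rw [smul_smul, mul_inv_cancel₀ (hcpos i).ne', one_smul]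
        · rw [smul_zero]
      rw [Finset.sum_congr rfl h4]
      -- The level sets cover only the points of nonzero mass; elsewhere `h j` vanishes.
      by_cases hz : h j ω = 0
      · simp [hz]
      · have hN : ‖h j ω‖ ^ q.toReal ≠ 0 :=
          (Real.rpow_pos_of_pos (norm_pos_iff.2 hz) _).ne'
        obtain ⟨k, hk⟩ := h1 fun h0 => hN (fibreNorm_rpow_eq_zero h0 j)
        have hkj : (k, j) ∈ I := by
          rw [hI]
          intro h0
          apply hN
          simp only at h0
          rw [← fibreProfile_mul_fibreMass, hk, h0, zero_mul]
        rw [Finset.sum_eq_single ⟨(k, j), hkj⟩, if_pos hk]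
        · intro i hi hne
          refine if_neg fun hi' => hne (Subtype.ext (Prod.ext ?_ (Finset.mem_filter.1 hi).2))
          exact hinj (hi'.symm.trans hk)
        · intro hn
          simp at hn
    · have : {y : Fin m → ℝ | ∃ k, y = x k} = Set.range x := by
        ext y; simp [eq_comm]
      exact this ▸ (Set.finite_range x).measurableSet

end Decomposition

end

/-! ### The matrix model of an `ℓ_p`-sum of `ℓ_q` spaces. -/

noncomputable section

theorem ae_count_fin {n : ℕ} {P : Fin n → Prop}
    (h : ∀ᵐ x ∂(Measure.count : Measure (Fin n)), P x) (x : Fin n) : P x :=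
  Measure.ae_count_iff.1 h x

/-- The unit vectors of `ℓ_q^m`. -/
def rowUnit (q : ℝ≥0∞) (m : ℕ) (j : Fin m) : Lp ℝ q (Measure.count : Measure (Fin m)) :=
  indicatorConstLp q (measurableSet_singleton j) (by simp) (1 : ℝ)

theorem rowUnit_apply {q : ℝ≥0∞} {m : ℕ} (j j' : Fin m) : rowUnit q m j j' = if j' = j then 1 else 0 := by
  rw [rowUnit, ae_count_fin indicatorConstLp_coeFn j', Set.indicator_apply]
  simp

theorem isDisjointPositive_rowUnit {q : ℝ≥0∞} {m : ℕ} : IsDisjointPositive (rowUnit q m) := by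
  rw [Lp.isDisjointPositive_iff (E := ℝ)]
  refine Filter.Eventually.of_forall fun j' => ⟨fun j => ?_, fun i j hij => ?_⟩
  · simp only [rowUnit_apply]
    split_ifs <;> norm_num
  · simp only [rowUnit_apply]
    split_ifs with h1 h2
    · exact absurd (h1.symm.trans h2) hij
    all_goals norm_num

section Model

variable (p q : ℝ≥0∞) [Fact (1 ≤ q)] (m L : ℕ)

/-- The lattice of `L × m` matrices with the norm of the `ℓ_p`-sum of `L` copies of `ℓ_q^m`. -/
abbrev MatrixLp :=
  MixedLp p q (Measure.count : Measure (Fin L)) (Measure.count : Measure (Fin m))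

variable {p q m L}

theorem MatrixLp.ext {f g : MatrixLp p q m L} (h : ∀ k j, f k j = g k j) : f = g :=
  Lp.ext (Measure.ae_count_iff.2 fun k => Lp.ext (Measure.ae_count_iff.2 (h k)))

theorem MatrixLp.le_iff {f g : MatrixLp p q m L} : f ≤ g ↔ ∀ k j, f k j ≤ g k j := by
  rw [← Lp.coeFn_le]
  refine Measure.ae_count_iff.trans (forall_congr' fun k => ?_)
  rw [← Lp.coeFn_le]
  exact Measure.ae_count_iff

theorem MatrixLp.abs_apply (f : MatrixLp p q m L) (k : Fin L) (j : Fin m) :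
    |f| k j = |f k j| := by
  rw [ae_count_fin (Lp.coeFn_abs f) k]
  exact ae_count_fin (Lp.coeFn_abs (f k)) j

theorem MatrixLp.sub_apply (f g : MatrixLp p q m L) (k : Fin L) (j : Fin m) :
    (f - g) k j = f k j - g k j := by
  rw [ae_count_fin (Lp.coeFn_sub f g) k]
  exact ae_count_fin (Lp.coeFn_sub (f k) (g k)) j

theorem MatrixLp.sum_smul_apply {ι : Type*} (s : Finset ι) (a : ι → ℝ) (f : ι → MatrixLp p q m L)
    (k : Fin L) (j : Fin m) : (∑ i ∈ s, a i • f i) k j = ∑ i ∈ s, a i * f i k j := by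
  rw [ae_count_fin (Lp.coeFn_sum_smul s a f) k]
  exact ae_count_fin (Lp.coeFn_sum_smul s a fun i => f i k) j

theorem norm_rowUnit (hq : q ≠ ∞) (j : Fin m) : ‖rowUnit q m j‖ = 1 := by
  rw [rowUnit, norm_indicatorConstLp (zero_lt_one.trans_le (Fact.out : 1 ≤ q)).ne' hq]
  simp

variable (p q m L) in
/-- The matrix units. -/
def matrixUnit (i : Fin L × Fin m) : MatrixLp p q m L :=
  indicatorConstLp p (measurableSet_singleton i.1) (by simp) (rowUnit q m i.2)

theorem matrixUnit_apply (i : Fin L × Fin m) (k : Fin L) :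
    matrixUnit p q m L i k = if k = i.1 then rowUnit q m i.2 else 0 := by
  rw [matrixUnit, ae_count_fin indicatorConstLp_coeFn k, Set.indicator_apply]
  simp

theorem matrixUnit_apply_apply (i : Fin L × Fin m) (k : Fin L) (j : Fin m) :
    matrixUnit p q m L i k j = if (k, j) = i then 1 else 0 := by
  rw [matrixUnit_apply]
  by_cases hk : k = i.1
  · rw [if_pos hk, rowUnit_apply]
    simp [Prod.ext_iff, hk]
  · rw [if_neg hk, if_neg fun h => hk (congrArg Prod.fst h)]
    exact ae_count_fin (Lp.coeFn_zero ℝ q _) j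

theorem isDisjointPositive_matrixUnit : IsDisjointPositive (matrixUnit p q m L) := by
  rw [Lp.isDisjointPositive_iff (E := Lp ℝ q (Measure.count : Measure (Fin m)))]
  have hv := isDisjointPositive_rowUnit (q := q) (m := m)
  refine Filter.Eventually.of_forall fun k => ⟨fun i => ?_, fun i i' hii => ?_⟩
  · simp only [matrixUnit_apply]
    split_ifs
    exacts [hv.1 _, le_rfl]
  · simp only [matrixUnit_apply]
    split_ifs with h1 h2 h3
    · exact hv.2 _ _ fun e => hii (Prod.ext (h1.symm.trans h2) e)
    · exact inf_eq_right.2 (hv.1 _)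
    · exact inf_eq_left.2 (hv.1 _)
    · exact inf_idem _

variable [Fact (1 ≤ p)] (I : Finset (Fin L × Fin m))

theorem hasRowBlockNorm_matrixUnit (hp : p ≠ ∞) (hq : q ≠ ∞) :
    HasRowBlockNorm p q I fun i => matrixUnit p q m L i := by
  intro a
  have hd : IsDisjointPositive fun i : I => matrixUnit p q m L i :=
    ⟨fun i => isDisjointPositive_matrixUnit.1 _,
      fun i i' h => isDisjointPositive_matrixUnit.2 _ _ fun e => h (Subtype.ext e)⟩
  rw [MixedLp.norm_sum_rpow hp hq hd, integral_count]
  refine Finset.sum_congr rfl fun k _ => ?_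
  congr 1
  rw [Finset.sum_filter]
  refine Finset.sum_congr rfl fun i _ => ?_
  rw [matrixUnit_apply]
  by_cases hk : k = i.1.1
  · rw [if_pos hk, if_pos hk.symm, norm_rowUnit hq, Real.one_rpow, mul_one]
  · rw [if_neg hk, if_neg (Ne.symm hk), norm_zero,
      Real.zero_rpow (toReal_pos_of_fact hq).ne', mul_zero]

theorem mem_range_combination_matrixUnit {f : MatrixLp p q m L} :
    f ∈ LinearMap.range (combination I fun i => matrixUnit p q m L i) ↔
      ∀ k j, (k, j) ∉ I → f k j = 0 := by
  constructor
  · rintro ⟨a, rfl⟩ k j hkj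
    rw [combination_apply, MatrixLp.sum_smul_apply]
    refine Finset.sum_eq_zero fun i _ => ?_
    rw [matrixUnit_apply_apply, if_neg fun e : (k, j) = i.1 => hkj (e ▸ i.2), mul_zero]
  · intro h
    refine ⟨fun i => f i.1.1 i.1.2, MatrixLp.ext fun k j => ?_⟩
    rw [combination_apply, MatrixLp.sum_smul_apply]
    simp only [matrixUnit_apply_apply, mul_ite, mul_one, mul_zero]
    by_cases hkj : (k, j) ∈ I
    · rw [Finset.sum_eq_single ⟨(k, j), hkj⟩]
      · simp
      · intro i _ hi
        exact if_neg fun e => hi (Subtype.ext e.symm)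
      · simp
    · rw [h k j hkj]
      exact Finset.sum_eq_zero fun i _ => if_neg fun e : (k, j) = i.1 => hkj (e ▸ i.2)

theorem isBand_range_combination_matrixUnit :
    IsBand (LinearMap.range (combination I fun i => matrixUnit p q m L i)) := by
  constructor
  · intro x y hy hxy
    rw [mem_range_combination_matrixUnit] at hy ⊢
    intro k j hkj
    have h1 := MatrixLp.le_iff.1 hxy k j
    rw [MatrixLp.abs_apply, MatrixLp.abs_apply, hy k j hkj, abs_zero] at h1
    exact abs_nonpos_iff.1 h1
  · intro A x hA hx
    rcases A.eq_empty_or_nonempty with rfl | ⟨a, ha⟩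
    -- A supremum of the empty set is a least element; comparing it with `0` and with its double
    -- shows that it is zero.
    · have hbot : ∀ y, x ≤ y := fun y => hx.2 (by simp [upperBounds_empty])
      have h1 : x ≤ 0 := hbot 0
      have h2 : 0 ≤ x := by
        have := hbot (x + x)
        rwa [le_add_iff_nonneg_left] at this
      rw [le_antisymm h1 h2]
      exact Submodule.zero_mem _
    · rw [mem_range_combination_matrixUnit]
      intro k j hkj
      have hzero : ∀ b ∈ A, b k j = 0 := fun b hb =>
        (mem_range_combination_matrixUnit I).1 (hA hb) k j hkj
      refine le_antisymm ?_ ?_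
      -- All members of `A` vanish at `(k, j)`, so erasing that entry of `x` leaves an upper bound.
      · have hub : x - ∑ i ∈ {(k, j)}, x k j • matrixUnit p q m L i ∈ upperBounds A := by
          intro b hb
          rw [MatrixLp.le_iff]
          intro k' j'
          rw [MatrixLp.sub_apply, MatrixLp.sum_smul_apply, Finset.sum_singleton,
            matrixUnit_apply_apply]
          split_ifs with h
          · obtain ⟨rfl, rfl⟩ := Prod.mk.inj h
            rw [hzero b hb, mul_one, sub_self]
          · rw [mul_zero, sub_zero]
            exact MatrixLp.le_iff.1 (hx.1 hb) k' j'
        have h1 := MatrixLp.le_iff.1 (hx.2 hub) k j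
        rw [MatrixLp.sub_apply, MatrixLp.sum_smul_apply, Finset.sum_singleton,
          matrixUnit_apply_apply, if_pos rfl, mul_one, sub_self] at h1
        exact h1
      · rw [← hzero a ha]
        exact MatrixLp.le_iff.1 (hx.1 ha) k j

variable {I}

/-- Disjoint positive elements with the norm of an `ℓ_p`-sum of `ℓ_q` spaces generate a
finite-dimensional `BL_pL_q` lattice. -/
theorem IsDisjointPositive.isBK_generate {X : Type*} [NormedAddCommGroup X] [NormedSpace ℝ X]
    [Lattice X] [IsOrderedAddMonoid X] [PosSMulMono ℝ X] (hp : p ≠ ∞) (hq : q ≠ ∞) {φ : I → X}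
    (hφ : IsDisjointPositive φ) (hne : ∀ i, φ i ≠ 0) (hrow : HasRowBlockNorm p q I φ) :
    IsBK p q (ClosedSublattice.generate (Set.range φ)).toSubmodule := by
  have hd : IsDisjointPositive fun i : I => matrixUnit p q m L i :=
    ⟨fun i => isDisjointPositive_matrixUnit.1 _,
      fun i i' h => isDisjointPositive_matrixUnit.2 _ _ fun e => h (Subtype.ext e)⟩
  obtain ⟨g, hg, -, hrange⟩ := hφ.exists_latticeEmbedding hd hne fun a => by
    have h := (hasRowBlockNorm_matrixUnit I hp hq a).trans (hrow a).symm
    exact (Real.rpow_left_inj (norm_nonneg _) (norm_nonneg _) (toReal_pos_of_fact hp).ne').1 h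
  refine ⟨?_, Fin L, Fin m, inferInstance, inferInstance, Measure.count, Measure.count, g, hg, ?_⟩
  · rw [hφ.generate_eq]
    infer_instance
  · rw [hrange]
    exact isBand_range_combination_matrixUnit I

end Model

end

noncomputable section

/-! ### Lattice embeddings and generated sublattices. -/

section Embeddings

theorem IsDisjointNormalizedPositive.isDisjointPositive {X ι : Type*} [NormedAddCommGroup X]
    [Lattice X] {x : ι → X} (h : IsDisjointNormalizedPositive x) : IsDisjointPositive x :=
  ⟨h.1, h.2.2⟩

theorem IsDisjointNormalizedPositive.ne_zero {X ι : Type*} [NormedAddCommGroup X]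
    [Lattice X] {x : ι → X} (h : IsDisjointNormalizedPositive x) (i : ι) : x i ≠ 0 := by
  intro h0
  have := h.2.1 i
  simp [h0] at this

theorem IsLatticeEmbedding.isDisjointPositive {E F ι : Type*} [NormedAddCommGroup E]
    [NormedSpace ℝ E] [Lattice E] [NormedAddCommGroup F] [NormedSpace ℝ F] [Lattice F]
    {f : E →ₗᵢ[ℝ] F} (hf : IsLatticeEmbedding f) {x : ι → E} (hx : IsDisjointPositive x) :
    IsDisjointPositive fun i => f (x i) := by
  refine ⟨fun i => ?_, fun i j hij => ?_⟩
  · have h := (hf 0 (x i)).1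
    rw [sup_eq_right.2 (hx.1 i), map_zero] at h
    exact sup_eq_right.1 h.symm
  · rw [← (hf _ _).2, hx.2 i j hij, map_zero]

theorem IsLatticeEmbedding.comp {E F G : Type*} [NormedAddCommGroup E] [NormedSpace ℝ E]
    [Lattice E] [NormedAddCommGroup F] [NormedSpace ℝ F] [Lattice F] [NormedAddCommGroup G]
    [NormedSpace ℝ G] [Lattice G] {g : F →ₗᵢ[ℝ] G} {f : E →ₗᵢ[ℝ] F}
    (hg : IsLatticeEmbedding g) (hf : IsLatticeEmbedding f) : IsLatticeEmbedding (g.comp f) :=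
  fun x y => ⟨(congrArg g (hf x y).1).trans (hg _ _).1, (congrArg g (hf x y).2).trans (hg _ _).2⟩

variable {X ι : Type*} [NormedAddCommGroup X] [NormedSpace ℝ X] [Lattice X]

/-- A generator as an element of the generated lattice. -/
def generator (x : ι → X) (i : ι) : (ClosedSublattice.generate (Set.range x)).toSubmodule :=
  ⟨x i, subset_generate _ ⟨i, rfl⟩⟩

theorem isDisjointPositive_generator {x : ι → X} (hx : IsDisjointPositive x) :
    IsDisjointPositive (generator x) :=
  ⟨fun i => hx.1 i, fun i j hij => Subtype.ext (hx.2 i j hij)⟩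

theorem norm_sum_smul_map_generator [Fintype ι] {F : Type*} [NormedAddCommGroup F]
    [NormedSpace ℝ F] {x : ι → X}
    (f : (ClosedSublattice.generate (Set.range x)).toSubmodule →ₗᵢ[ℝ] F) (a : ι → ℝ) :
    ‖∑ i, a i • f (generator x i)‖ = ‖∑ i, a i • x i‖ := by
  have h : ∑ i, a i • f (generator x i) = f (∑ i, a i • generator x i) := by simp
  rw [h, f.norm_map, Submodule.coe_norm]
  congr 1
  simp [generator]

/-- The inclusion of closed sublattices is a lattice embedding. -/
theorem exists_inclusion {S T : ClosedSublattice X} (h : S.toSubmodule ≤ T.toSubmodule) :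
    ∃ f : S.toSubmodule →ₗᵢ[ℝ] T.toSubmodule, IsLatticeEmbedding f ∧ ∀ x, (f x : X) = x :=
  ⟨{ toLinearMap := Submodule.inclusion h, norm_map' := fun _ => rfl },
    fun _ _ => ⟨rfl, rfl⟩, fun _ => rfl⟩

end Embeddings

/-! ### Consequences of the block norm formula. -/

theorem HasRowBlockNorm.norm_sum_eq {p q : ℝ≥0∞} [Fact (1 ≤ p)] (hp : p ≠ ∞)
    {X Y : Type*} [NormedAddCommGroup X] [NormedSpace ℝ X] [NormedAddCommGroup Y] [NormedSpace ℝ Y]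
    {m L : ℕ} {I : Finset (Fin L × Fin m)} {φ : I → X} {ψ : I → Y} (h : HasRowBlockNorm p q I φ) (h' : HasRowBlockNorm p q I ψ)
    (a : I → ℝ) : ‖∑ i, a i • ψ i‖ = ‖∑ i, a i • φ i‖ :=
  (Real.rpow_left_inj (norm_nonneg _) (norm_nonneg _) (toReal_pos_of_fact hp).ne').1
    ((h' a).trans (h a).symm)

section RowBlocks

variable {p q : ℝ≥0∞} [Fact (1 ≤ p)] [Fact (1 ≤ q)] {X : Type*} [NormedAddCommGroup X]
  [NormedSpace ℝ X] {m L : ℕ} {I : Finset (Fin L × Fin m)} {φ : I → X}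

/-- A column meets each row at most once, so each inner `ℓ_q` sum has at most one term and
`(|a|^q)^(p/q) = |a|^p`. -/
theorem HasRowBlockNorm.norm_column (hp : p ≠ ∞) (hq : q ≠ ∞) (h : HasRowBlockNorm p q I φ)
    (j : Fin m) (a : I → ℝ) : ‖∑ i : I with i.1.2 = j, a i • φ i‖ ^ p.toReal =
      ∑ i : I with i.1.2 = j, |a i| ^ p.toReal := by
  have hp' := toReal_pos_of_fact hp
  have hq' := toReal_pos_of_fact hq
  have h1 := h fun i => if i.1.2 = j then a i else 0
  simp only [ite_smul, zero_smul] at h1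
  rw [Finset.sum_filter, h1, Finset.sum_filter, ← Finset.sum_fiberwise _ fun i : I => i.1.1]
  refine Finset.sum_congr rfl fun k _ => ?_
  by_cases hkj : (k, j) ∈ I
  · have hne : ∀ i ∈ Finset.univ.filter (fun i : I => i.1.1 = k), i ≠ ⟨(k, j), hkj⟩ →
        i.1.2 ≠ j := fun i hi hi' e =>
      hi' (Subtype.ext (Prod.ext (Finset.mem_filter.1 hi).2 e))
    rw [Finset.sum_eq_single_of_mem ⟨(k, j), hkj⟩ (by simp), if_pos rfl,
      Finset.sum_eq_single_of_mem ⟨(k, j), hkj⟩ (by simp), if_pos rfl,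
      ← Real.rpow_mul (abs_nonneg _), mul_div_cancel₀ _ hq'.ne']
    · intro i hi hi'
      rw [if_neg (hne i hi hi')]
    · intro i hi hi'
      rw [if_neg (hne i hi hi'), abs_zero, Real.zero_rpow hq'.ne']
  · have hne : ∀ i ∈ Finset.univ.filter (fun i : I => i.1.1 = k), i.1.2 ≠ j := fun i hi e =>
      hkj (by rw [← (Finset.mem_filter.1 hi).2, ← e]; exact i.2)
    rw [Finset.sum_eq_zero fun i hi => if_neg (hne i hi), Finset.sum_eq_zero fun i hi => by
      rw [if_neg (hne i hi), abs_zero, Real.zero_rpow hq'.ne'],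
      Real.zero_rpow (div_pos hp' hq').ne']

theorem HasRowBlockNorm.norm_eq_one (hp : p ≠ ∞) (hq : q ≠ ∞) (h : HasRowBlockNorm p q I φ)
    (i : I) : ‖φ i‖ = 1 := by
  classical
  have hp' := toReal_pos_of_fact hp
  have h1 := h.norm_column hp hq i.1.2 (Pi.single i 1)
  rw [Finset.sum_eq_single_of_mem i (by simp), Finset.sum_eq_single_of_mem i (by simp),
    Pi.single_eq_same, one_smul, abs_one] at h1
  · exact (Real.rpow_left_inj (norm_nonneg _) zero_le_one hp'.ne').1 h1
  · intro b _ hb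
    rw [Pi.single_eq_of_ne hb, abs_zero, Real.zero_rpow hp'.ne']
  · intro b _ hb
    rw [Pi.single_eq_of_ne hb, zero_smul]

theorem sum_smul_sum_column (a : Fin m → ℝ) (c : I → ℝ) {x : Fin m → X}
    (hx : ∀ j, x j = ∑ i : I with i.1.2 = j, c i • φ i) :
    ∑ j, a j • x j = ∑ i : I, (a i.1.2 * c i) • φ i := by
  rw [← Finset.sum_fiberwise _ fun i : I => i.1.2]
  refine Finset.sum_congr rfl fun j _ => ?_
  rw [hx, Finset.smul_sum]
  refine Finset.sum_congr rfl fun i hi => ?_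
  rw [(Finset.mem_filter.1 hi).2, smul_smul]

end RowBlocks

/-! ### Invariance of the profile measure and extension of embeddings. -/

section Main

variable {p q : ℝ≥0∞} [Fact (1 ≤ p)] [Fact (1 ≤ q)] {m : ℕ}

/-- An embedding keeps disjointness and the norms of combinations, which determine the profile
measure. The target may be over any measure spaces, so this covers both the ambient space of the
band and `[0,1]`. -/
theorem profileMeasure_map_generator {Ω Ω' Ω₁ Ω₁' : Type*} [MeasurableSpace Ω]
    [MeasurableSpace Ω'] [MeasurableSpace Ω₁] [MeasurableSpace Ω₁'] {μ : Measure Ω}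
    {ν : Measure Ω'} {μ₁ : Measure Ω₁} {ν₁ : Measure Ω₁'} (hp : p ≠ ∞) (hq : q ≠ ∞)
    (hpq : ∀ n : ℕ, p / q ≠ (n : ℝ≥0∞)) {e : Fin m → MixedLp p q μ ν} (he : IsDisjointPositive e)
    {f : (ClosedSublattice.generate (Set.range e)).toSubmodule →ₗᵢ[ℝ] MixedLp p q μ₁ ν₁}
    (hf : IsLatticeEmbedding f) :
    profileMeasure (fun j => f (generator e j)) = profileMeasure e :=
  profileMeasure_eq_of_norm_eq hp hq hpq (hf.isDisjointPositive (isDisjointPositive_generator he))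
    he (norm_sum_smul_map_generator f)

/-- The profile measure of a basis of a sublattice of a finite-dimensional `BL_pL_q` lattice is
purely atomic with finitely many atoms. -/
theorem exists_atoms_profileMeasure {Ω Ω' : Type*} [MeasurableSpace Ω]
    [MeasurableSpace Ω'] {μ : Measure Ω} {ν : Measure Ω'} (hp : p ≠ ∞) (hq : q ≠ ∞)
    (hpq : ∀ n : ℕ, p / q ≠ (n : ℝ≥0∞)) {e : Fin m → MixedLp p q μ ν} (he : IsDisjointPositive e)
    (hK : IsK p q (ClosedSublattice.generate (Set.range e)).toSubmodule) :
    ∃ (L : ℕ) (x : Fin L → Fin m → ℝ), Function.Injective x ∧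
      (∀ k, profileMeasure e {x k} ≠ 0) ∧ ∀ᵐ y ∂(profileMeasure e), ∃ k, y = x k := by
  classical
  obtain ⟨F, _, _, _, ⟨hfd, Ω₁, Ω₁', _, _, μ₁, ν₁, g, hg, hband⟩, f, hf⟩ := hK
  have hgf := hg.comp hf
  obtain ⟨K, hK⟩ := exists_finset_profileMeasure_compl_eq_zero hp hq
    (hgf.isDisjointPositive (isDisjointPositive_generator he)) (LinearMap.range g.toLinearMap)
    hband.1 fun j => ⟨f (generator e j), rfl⟩
  rw [profileMeasure_map_generator hp hq hpq he hgf] at hK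
  -- Null points are dropped, because the pieces are later divided by weights that must be positive.
  let K' := K.filter fun y => profileMeasure e {y} ≠ 0
  refine ⟨K'.card, fun k => (K'.equivFin.symm k).1, fun k l hkl => ?_, fun k => ?_, ?_⟩
  · exact K'.equivFin.symm.injective (Subtype.ext hkl)
  · exact (Finset.mem_filter.1 (K'.equivFin.symm k).2).2
  · have h1 : ∀ᵐ y ∂(profileMeasure e), y ∈ K := by
      rw [ae_iff]
      exact hK
    have h2 : ∀ᵐ y ∂(profileMeasure e), ∀ z ∈ K.filter fun y => profileMeasure e {y} = 0, y ≠ z := by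
      rw [Filter.eventually_all_finset]
      intro z hz
      rw [ae_iff]
      simpa using (Finset.mem_filter.1 hz).2
    filter_upwards [h1, h2] with y hy1 hy2
    have hy : y ∈ K' := by
      refine Finset.mem_filter.2 ⟨hy1, fun h0 => hy2 y (Finset.mem_filter.2 ⟨hy1, h0⟩) rfl⟩
    exact ⟨K'.equivFin ⟨y, hy⟩, by simp⟩

theorem IsAtomRefinement.generate_le {L : ℕ} {e : Fin m → LpLq p q}
    {I : Finset (Fin L × Fin m)} {φ : I → LpLq p q} (h : IsAtomRefinement p q e I φ) :
    (ClosedSublattice.generate (Set.range e)).toSubmodule ≤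
      (ClosedSublattice.generate (Set.range φ)).toSubmodule := by
  refine _root_.generate_le ?_
  rintro _ ⟨j, rfl⟩
  exact _root_.generate_le ((Set.image_subset_range _ _).trans (subset_generate _)) (h.2.1 j)

theorem isK_of_isAtomRefinement {L : ℕ} {e : Fin m → LpLq p q} {I : Finset (Fin L × Fin m)}
    {φ : I → LpLq p q} (h : IsAtomRefinement p q e I φ) :
    IsK p q (ClosedSublattice.generate (Set.range e)).toSubmodule := by
  obtain ⟨ι, hι, -⟩ := exists_inclusion h.generate_le
  exact ⟨_, _, _, _, h.2.2.2, ι, hι⟩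

theorem isAtomRefinement_of_decomposition {L : ℕ} (hp : p ≠ ∞) (hq : q ≠ ∞)
    {e : Fin m → LpLq p q} {I : Finset (Fin L × Fin m)} {φ : I → LpLq p q}
    (hφ : IsDisjointPositive φ) (hrow : HasRowBlockNorm p q I φ) {c : I → ℝ}
    (he : ∀ j, e j = ∑ i : I with i.1.2 = j, c i • φ i) : IsAtomRefinement p q e I φ := by
  have hnorm : IsDisjointNormalizedPositive φ := ⟨hφ.1, hrow.norm_eq_one hp hq, hφ.2⟩
  refine ⟨hnorm, fun j => ?_, hrow.norm_column hp hq, hφ.isBK_generate hp hq hnorm.ne_zero hrow⟩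
  rw [he]
  exact Submodule.sum_mem _ fun i hi => Submodule.smul_mem _ _
    (subset_generate _ ⟨i, (Finset.mem_filter.1 hi).2, rfl⟩)

/-- Every embedding of a sublattice of a finite-dimensional `BL_pL_q` lattice refines its basis
into the atoms of an `ℓ_p`-sum of `ℓ_q` spaces, with coefficients that do not depend on the
embedding. -/
theorem exists_uniform_refinement {e : Fin m → LpLq p q} (hp : p ≠ ∞) (hq : q ≠ ∞)
    (hpq : ∀ n : ℕ, p / q ≠ (n : ℝ≥0∞)) (he : IsDisjointPositive e)
    (hK : IsK p q (ClosedSublattice.generate (Set.range e)).toSubmodule) :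
    ∃ (L : ℕ) (I : Finset (Fin L × Fin m)) (c : I → ℝ),
      ∀ f : (ClosedSublattice.generate (Set.range e)).toSubmodule →ₗᵢ[ℝ] LpLq p q,
        IsLatticeEmbedding f → ∃ φ : I → LpLq p q, IsDisjointPositive φ ∧
          HasRowBlockNorm p q I φ ∧ ∀ j, f (generator e j) = ∑ i : I with i.1.2 = j, c i • φ i := by
  obtain ⟨L, x, hinj, hpos, hae⟩ := exists_atoms_profileMeasure hp hq hpq he hK
  refine ⟨L, Finset.univ.filter fun i => x i.1 i.2 ≠ 0, fun i =>
    atomWeight p q ((profileMeasure e).real {x i.1.1}) (x i.1.1) i.1.2, fun f hf => ?_⟩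
  have hσ := profileMeasure_map_generator hp hq hpq he hf
  -- The coefficients were fixed from the profile measure of `e`; by invariance they are also those
  -- of its image under `f`.
  simp only [← hσ] at hpos hae ⊢
  exact exists_rowBlock_decomposition hp hq
    (hf.isDisjointPositive (isDisjointPositive_generator he)) hinj hpos hae
    fun i => by rw [Finset.mem_filter]; exact and_iff_right (Finset.mem_univ i)

theorem isLatticeEmbedding_subtype {X : Type*} [NormedAddCommGroup X] [NormedSpace ℝ X] [Lattice X]
    (S : ClosedSublattice X) : IsLatticeEmbedding S.toSubmodule.subtypeₗᵢ :=
  fun _ _ => ⟨rfl, rfl⟩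

/-- Two embeddings of the lattice spanned by `e` and of its refinement `φ` that agree on the
coefficients: the first extends to the second. -/
theorem exists_extension {L : ℕ} {e : Fin m → LpLq p q} {I : Finset (Fin L × Fin m)}
    {φ ψ : I → LpLq p q} {c : I → ℝ} (hp : p ≠ ∞) (he : IsDisjointPositive e)
    (hφ : IsDisjointPositive φ) (hne : ∀ i, φ i ≠ 0) (hrow : HasRowBlockNorm p q I φ)
    (hcol : ∀ j, e j = ∑ i : I with i.1.2 = j, c i • φ i)
    {ι : (ClosedSublattice.generate (Set.range e)).toSubmodule →ₗᵢ[ℝ]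
      (ClosedSublattice.generate (Set.range φ)).toSubmodule}
    (hι : ∀ x, (ι x : LpLq p q) = x)
    {f : (ClosedSublattice.generate (Set.range e)).toSubmodule →ₗᵢ[ℝ] LpLq p q}
    (hψ : IsDisjointPositive ψ) (hrow' : HasRowBlockNorm p q I ψ)
    (hcol' : ∀ j, f (generator e j) = ∑ i : I with i.1.2 = j, c i • ψ i) :
    ∃ g : (ClosedSublattice.generate (Set.range φ)).toSubmodule →ₗᵢ[ℝ] LpLq p q,
      IsLatticeEmbedding g ∧ ∀ x, g (ι x) = f x := by
  obtain ⟨g, hg, hgval, -⟩ := hφ.exists_latticeEmbedding hψ hne (hrow.norm_sum_eq hp hrow')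
  refine ⟨g, hg, fun x => ?_⟩
  obtain ⟨a, ha⟩ := he.generate_eq.le x.2
  rw [combination_apply] at ha
  have hx : x = ∑ j, a j • generator e j := Subtype.ext (by simp [← ha, generator])
  have hf : f x = ∑ j, a j • f (generator e j) := by
    conv_lhs => rw [hx]
    rw [map_sum]
    exact Finset.sum_congr rfl fun j _ => map_smul f _ _
  -- The coordinates `a j * c (k, j)` on the pieces are the same for `φ` and for `ψ`, so `g` carries
  -- `x` to `f x`.
  have hιx : (ι x : LpLq p q) = ∑ i : I, (a i.1.2 * c i) • φ i := by
    rw [hι, ← ha]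
    exact sum_smul_sum_column a c hcol
  rw [hgval (fun i => a i.1.2 * c i) _ hιx, hf, sum_smul_sum_column a c hcol']

end Main

end

set_option maxHeartbeats 1000000 in
theorem theoremt (p q : ℝ≥0∞) [Fact (1 ≤ p)] [Fact (1 ≤ q)] (hp : p ≠ ∞) (hq : q ≠ ∞)
    (hpq : ∀ n : ℕ, p / q ≠ (n : ℝ≥0∞)) (m : ℕ) (e : Fin m → LpLq p q)
    (he : IsDisjointNormalizedPositive e) :
    (IsK p q (ClosedSublattice.generate (Set.range e)).toSubmodule ↔
      ∃ (L : ℕ) (I : Finset (Fin L × Fin m)) (φ : I → LpLq p q), IsAtomRefinement p q e I φ) ∧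
    (IsK p q (ClosedSublattice.generate (Set.range e)).toSubmodule →
      ∃ (L : ℕ) (I : Finset (Fin L × Fin m)) (φ : I → LpLq p q),
        IsAtomRefinement p q e I φ ∧ HasRowBlocks p q I φ) ∧
    (IsK p q (ClosedSublattice.generate (Set.range e)).toSubmodule →
      ∀ f₁ f₂ : (ClosedSublattice.generate (Set.range e)).toSubmodule →ₗᵢ[ℝ] LpLq p q,
        IsLatticeEmbedding f₁ → IsLatticeEmbedding f₂ →
        ∃ (E' : Type) (_ : NormedAddCommGroup E') (_ : NormedSpace ℝ E') (_ : Lattice E')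
          (ι : (ClosedSublattice.generate (Set.range e)).toSubmodule →ₗᵢ[ℝ] E')
          (g₁ g₂ : E' →ₗᵢ[ℝ] LpLq p q),
          IsBK p q E' ∧ IsLatticeEmbedding ι ∧ IsLatticeEmbedding g₁ ∧ IsLatticeEmbedding g₂ ∧
          (∀ x, g₁ (ι x) = f₁ x) ∧ (∀ x, g₂ (ι x) = f₂ x)) := by
  have hed := he.isDisjointPositive
  have hrefine : IsK p q (ClosedSublattice.generate (Set.range e)).toSubmodule →
      ∃ (L : ℕ) (I : Finset (Fin L × Fin m)) (φ : I → LpLq p q),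
        IsAtomRefinement p q e I φ ∧ HasRowBlocks p q I φ := by
    intro hK
    obtain ⟨L, I, c, hdec⟩ := exists_uniform_refinement hp hq hpq hed hK
    -- The inclusion of the generated lattice is itself an embedding; its splitting is that of `e`.
    obtain ⟨φ, hφ, hrow, hcol⟩ := hdec _ (isLatticeEmbedding_subtype _)
    exact ⟨L, I, φ, isAtomRefinement_of_decomposition hp hq hφ hrow hcol, hrow⟩
  refine ⟨⟨fun hK => ?_, fun ⟨L, I, φ, h⟩ => isK_of_isAtomRefinement h⟩, hrefine, ?_⟩
  · obtain ⟨L, I, φ, h, -⟩ := hrefine hK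
    exact ⟨L, I, φ, h⟩
  · intro hK f₁ f₂ hf₁ hf₂
    obtain ⟨L, I, c, hdec⟩ := exists_uniform_refinement hp hq hpq hed hK
    obtain ⟨φ, hφ, hrow, hcol⟩ := hdec _ (isLatticeEmbedding_subtype _)
    have hcol' : ∀ j, e j = ∑ i : I with i.1.2 = j, c i • φ i := hcol
    have href := isAtomRefinement_of_decomposition hp hq hφ hrow hcol'
    obtain ⟨ι, hι, hιx⟩ := exists_inclusion href.generate_le
    -- The same index set and coefficients `c` serve `f₁`, `f₂` and the inclusion, which is what
    -- allows one lattice `E'` for both extensions.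
    obtain ⟨ψ₁, hψ₁, hrow₁, hcol₁⟩ := hdec f₁ hf₁
    obtain ⟨ψ₂, hψ₂, hrow₂, hcol₂⟩ := hdec f₂ hf₂
    obtain ⟨g₁, hg₁, hgf₁⟩ :=
      exists_extension hp hed hφ href.1.ne_zero hrow hcol' hιx hψ₁ hrow₁ hcol₁
    obtain ⟨g₂, hg₂, hgf₂⟩ :=
      exists_extension hp hed hφ href.1.ne_zero hrow hcol' hιx hψ₂ hrow₂ hcol₂
    exact ⟨_, _, _, _, ι, g₁, g₂, href.2.2.2, hι, hg₁, hg₂, hgf₁, hgf₂⟩
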